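/- Let $\Lambda$ be a finite index set, let $\Omega\subset\mathbb{R}^d$ be open, bounded and connected, and let $X\subset\Omega$ be compact with non-empty interior. For each $i\in\Lambda$ let $\varphi_i\colon\Omega\to\Omega$ be a conformal $C^{1+\varepsilon}$-diffeomorphism onto its image (that is, $\varphi_i$ is injective, its derivative is locally Hölder continuous, and each $\varphi_i'(x)$ is a similarity, i.e. a positive multiple of a linear isometry), such that $\varphi_i(X)\subset X$ and $\varphi_i|_X$ is a contraction. Let $F\subset X$ be the limit set, i.e. the unique non-empty compact subset of $X$ with $F=\bigcup_{i\in\Lambda}\varphi_i(F)$, and assume the strong separation condition: $\varphi_i(F)\cap\varphi_j(F)=\emptyset$ for $i\neq j$. For each $i\in\Lambda$ let $p_i\colon X\to(0,1)$ be Hölder continuous, with $\sum_{i\in\Lambda}p_i(x)=1$ for all $x\in X$, and let $\mu$ be the invariant measure with place dependent probabilities $p_i$, i.e. the Borel probability measure on $X$ with $$\mu(B)=\sum_{i\in\Lambda}\int_{\varphi_i^{-1}(B)}p_i\,d\mu\qquad\text{for all Borel sets }B\subset X .$$ Let $\Sigma=\Lambda^{\mathbb{N}}$ be the set of infinite words $\mathbf{i}=(i_1,i_2,\ldots)$,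 let $\sigma$ be the left shift on $\Sigma$, let $P(\Sigma)$ be the set of $\sigma$-periodic words, let $\varphi_{\mathbf{i}|_n}=\varphi_{i_1}\circ\cdots\circ\varphi_{i_n}$, and let $\pi\colon\Sigma\to F$ be the coding map, $\{\pi(\mathbf{i})\}=\bigcap_{n\ge1}\varphi_{\mathbf{i}|_n}(F)$. For $\mathbf{i}\in P(\Sigma)$ with (minimal) period $n$ put $$\overline{p}_{\mathbf{i}}=\prod_{k=1}^{n}p_{i_k}\bigl(\pi(\sigma^{k}\mathbf{i})\bigr),\qquad |\varphi'_{\mathbf{i}}|=\bigl|\varphi'_{\mathbf{i}|_n}(\pi(\mathbf{i}))\bigr|,$$ where $|\cdot|$ on the right is the operator norm. Then $$\dim_{\mathrm{A}}\mu=\sup_{\mathbf{i}\in P(\Sigma)}\frac{\log\overline{p}_{\mathbf{i}}}{\log|\varphi'_{\mathbf{i}}|},$$ where, with closed balls $B(x,r)$, $$\dim_{\mathrm{A}}\mu=\inf\Bigl\{s>0:\ \exists\,C>0\ \text{ such that }\ \frac{\mu(B(x,R))}{\mu(B(x,r))}\le C\Bigl(\frac{R}{r}\Bigr)^{s}\ \text{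 for all }x\in\operatorname{supp}\mu,\ 0<r<R\Bigr\}$$ (and $\inf\emptyset=\infty$). -/

import Mathlib

open Set MeasureTheory
open scoped NNReal ENNReal

noncomputable section

/-- The Assouad dimension of a measure: the infimum of all `s > 0` for which there is `C > 0` with
`μ (B(x, R)) / μ (B(x, r)) ≤ C (R / r) ^ s` for all `x` in the support of `μ` and all `0 < r < R`
(closed balls). It is `⊤` if there is no such `s`. -/
def assouadDim {E : Type*} [PseudoMetricSpace E] [MeasurableSpace E] (μ : Measure E) : EReal :=
  ⨅ (s : ℝ) (_ : 0 < s ∧ ∃ C : ℝ, 0 < C ∧ ∀ x ∈ μ.support, ∀ r R : ℝ, 0 < r → r < R →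
      μ (Metric.closedBall x R) ≤ ENNReal.ofReal (C * (R / r) ^ s) * μ (Metric.closedBall x r)),
    (s : EReal)

/-- The left shift on infinite words; the letters of a word are indexed by `0, 1, 2, …`. -/
def wordShift {Λ : Type*} (w : ℕ → Λ) : ℕ → Λ := fun k => w (k + 1)

/-- `wordMap φ w n = φ (w 0) ∘ φ (w 1) ∘ ⋯ ∘ φ (w (n - 1))`. -/
def wordMap {Λ E : Type*} (φ : Λ → E → E) (w : ℕ → Λ) : ℕ → E → E
  | 0 => id
  | n + 1 => wordMap φ w n ∘ φ (w n)

/-- A self-conformal iterated function system on `ℝ^d`: contractions of the compact set `X` which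
extend to conformal `C^{1+ε}`-diffeomorphisms of the bounded domain `Ω ⊇ X` into itself. The maps
are total functions, but only their restrictions to `Ω` matter. The Hölder condition on the
derivative is required on compact subsets of `Ω` only. -/
structure IsSelfConformalIFS {Λ : Type*} {d : ℕ}
    (φ : Λ → EuclideanSpace ℝ (Fin d) → EuclideanSpace ℝ (Fin d))
    (Ω X : Set (EuclideanSpace ℝ (Fin d))) : Prop where
  isOpen : IsOpen Ω
  isBounded : Bornology.IsBounded Ω
  isConnected : IsConnected Ω
  isCompact : IsCompact X
  subset : X ⊆ Ω
  interior_nonempty : (interior X).Nonempty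
  mapsTo_compact : ∀ i, MapsTo (φ i) X X
  contraction : ∀ i, ∃ c : ℝ≥0, c < 1 ∧ LipschitzOnWith c (φ i) X
  mapsTo_domain : ∀ i, MapsTo (φ i) Ω Ω
  injOn : ∀ i, InjOn (φ i) Ω
  contDiffOn : ∀ i, ContDiffOn ℝ 1 (φ i) Ω
  holder_fderiv : ∀ i, ∃ ε : ℝ≥0, 0 < ε ∧ ∀ K ⊆ Ω, IsCompact K →
    ∃ C : ℝ≥0, HolderOnWith C ε (fderiv ℝ (φ i)) K
  conformal : ∀ i, ∀ x ∈ Ω, ConformalAt (φ i) x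

/-- `F` is the limit set of the system `φ` of contractions of `X`: the unique non-empty compact
subset of `X` that is the union of its images under the maps. -/
structure IsLimitSet {Λ E : Type*} [TopologicalSpace E] (φ : Λ → E → E) (X F : Set E) : Prop where
  subset : F ⊆ X
  nonempty : F.Nonempty
  isCompact : IsCompact F
  eq_iUnion : F = ⋃ i, φ i '' F

/-- The strong separation condition. -/
def StrongSeparation {Λ E : Type*} (φ : Λ → E → E) (F : Set E) : Prop :=
  ∀ i j, i ≠ j → Disjoint (φ i '' F) (φ j '' F)

/-- The coding map: `codingMap φ F w` is the only point of `⋂ₙ φ_{w|n}(F)`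
(see `iInter_wordMap_image_eq`). -/
def codingMap {Λ E : Type*} [Nonempty E] (φ : Λ → E → E) (F : Set E) (w : ℕ → Λ) : E :=
  Classical.epsilon fun x => ⋂ n : ℕ, wordMap φ w (n + 1) '' F = {x}

/-- Hölder continuous place dependent probabilities `p i : X → (0, 1)` with sum one. -/
structure IsPlaceDependentProb {Λ E : Type*} [Fintype Λ] [PseudoEMetricSpace E]
    (p : Λ → E → ℝ) (X : Set E) : Prop where
  holder : ∀ i, ∃ α C : ℝ≥0, 0 < α ∧ HolderOnWith C α (p i) X
  mem_Ioo : ∀ i, ∀ x ∈ X, p i x ∈ Ioo (0 : ℝ) 1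
  sum_eq_one : ∀ x ∈ X, ∑ i, p i x = 1

/-- `μ` is a Borel probability measure on `X` (given as a measure on the ambient space that does not
charge the complement of `X`) with `T* μ = μ`, that is
`μ B = ∑ i, ∫_{φ i ⁻¹ B} p i dμ` for all Borel sets `B ⊆ X`. -/
structure IsInvariantMeasure {Λ E : Type*} [Fintype Λ] [MeasurableSpace E]
    (φ : Λ → E → E) (p : Λ → E → ℝ) (X : Set E) (μ : Measure E) : Prop where
  isProbabilityMeasure : IsProbabilityMeasure μ
  compl_eq_zero : μ Xᶜ = 0
  invariant : ∀ B ⊆ X, MeasurableSet B →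
    μ B = ∑ i, ∫⁻ x in X ∩ φ i ⁻¹' B, ENNReal.ofReal (p i x) ∂μ

/-- `p_{w|n}(w) = ∏_{k=1}^{n} p_{w_k}(π(σ^k w))`, where `π` is the coding map and `σ` is the shift
(with letters `w_1, w_2, …`; in the code the `k`-th letter is `w (k - 1)`). -/
def wordProb {Λ E : Type*} [Nonempty E] (φ : Λ → E → E) (F : Set E) (p : Λ → E → ℝ)
    (w : ℕ → Λ) (n : ℕ) : ℝ :=
  ∏ k ∈ Finset.range n, p (w k) (codingMap φ F (wordShift^[k + 1] w))

/-- For a periodic word `w` with period of length `n`: the product `p_{w|n}(w)` of the place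
dependent probabilities along one period. -/
def periodProb {Λ E : Type*} [Nonempty E] (φ : Λ → E → E) (F : Set E) (p : Λ → E → ℝ)
    (w : ℕ → Λ) : ℝ :=
  wordProb φ F p w (Function.minimalPeriod wordShift w)

/-- For a periodic word `w` with period of length `n`: the operator norm of the derivative of the
period map `φ_{w|n}` at its fixed point `π(w)`. -/
def periodDeriv {Λ E : Type*} [NormedAddCommGroup E] [NormedSpace ℝ E] (φ : Λ → E → E) (F : Set E)
    (w : ℕ → Λ) : ℝ :=
  ‖fderiv ℝ (wordMap φ w (Function.minimalPeriod wordShift w)) (codingMap φ F w)‖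

theorem wordMap_image_subset {Λ E : Type*} [TopologicalSpace E] {φ : Λ → E → E} {X F : Set E}
    (hF : IsLimitSet φ X F) (w : ℕ → Λ) (n : ℕ) :
    wordMap φ w (n + 1) '' F ⊆ wordMap φ w n '' F := by
  rintro _ ⟨x, hx, rfl⟩
  refine ⟨φ (w n) x, ?_, rfl⟩
  rw [hF.eq_iUnion]
  exact mem_iUnion.2 ⟨w n, x, hx, rfl⟩

/-- The coding map is well defined. -/
theorem iInter_wordMap_image_eq {Λ : Type*} [Finite Λ] {d : ℕ}
    {φ : Λ → EuclideanSpace ℝ (Fin d) → EuclideanSpace ℝ (Fin d)}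
    {Ω X F : Set (EuclideanSpace ℝ (Fin d))}
    (hφ : IsSelfConformalIFS φ Ω X) (hF : IsLimitSet φ X F) (w : ℕ → Λ) :
    ⋂ n : ℕ, wordMap φ w (n + 1) '' F = {codingMap φ F w} := by
  have key : ∃ x, ⋂ n : ℕ, wordMap φ w (n + 1) '' F = {x} := by
    choose c hc hL using hφ.contraction
    obtain ⟨c₀, hc₀, hcc⟩ : ∃ c₀ : ℝ≥0, c₀ < 1 ∧ ∀ i, c i ≤ c₀ := by
      have : Nonempty Λ := ⟨w 0⟩
      obtain ⟨i, hi⟩ := Finite.exists_max c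
      exact ⟨c i, hc i, hi⟩
    have hlip : ∀ n, LipschitzOnWith (c₀ ^ n) (wordMap φ w n) X := by
      intro n
      induction n with
      | zero => simpa [wordMap] using LipschitzWith.id.lipschitzOnWith
      | succ n ih =>
        rw [pow_succ]
        exact ih.comp ((hL (w n)).weaken (hcc _)) (hφ.mapsTo_compact _)
    have hcpt : ∀ n, IsCompact (wordMap φ w n '' F) := fun n =>
      hF.isCompact.image_of_continuousOn ((hlip n).continuousOn.mono hF.subset)
    obtain ⟨x, hx⟩ := IsCompact.nonempty_iInter_of_sequence_nonempty_isCompact_isClosed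
      (fun n => wordMap φ w (n + 1) '' F) (fun n => wordMap_image_subset hF w (n + 1))
      (fun n => hF.nonempty.image _) (hcpt 1) (fun n => (hcpt _).isClosed)
    refine ⟨x, Subset.antisymm ?_ (singleton_subset_iff.2 hx)⟩
    intro y hy
    rw [mem_singleton_iff, ← dist_le_zero]
    have hbd : ∀ n : ℕ, dist y x ≤ (c₀ : ℝ) ^ (n + 1) * Metric.diam F := by
      intro n
      obtain ⟨a, ha, rfl⟩ := mem_iInter.1 hy n
      obtain ⟨b, hb, hbx⟩ := mem_iInter.1 hx n
      rw [← hbx]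
      have h1 := (hlip (n + 1)).dist_le_mul a (hF.subset ha) b (hF.subset hb)
      push_cast at h1
      refine h1.trans ?_
      gcongr
      exact Metric.dist_le_diam_of_mem hF.isCompact.isBounded ha hb
    have ht : Filter.Tendsto (fun n : ℕ => (c₀ : ℝ) ^ (n + 1) * Metric.diam F) Filter.atTop
        (nhds 0) := by
      have := ((Filter.tendsto_add_atTop_iff_nat 1).2
        (tendsto_pow_atTop_nhds_zero_of_lt_one c₀.coe_nonneg
          (by exact_mod_cast hc₀))).mul_const (Metric.diam F)
      simpa using this
    exact ge_of_tendsto' ht hbd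
  exact Classical.epsilon_spec key

end

/-! Under strong separation everything can be read off the symbolic space. Let `a` be the log
contraction rate and `b` the log probability of the first letter. Up to uniform multiplicative
constants, the `n`-cylinder of `w` looks like a ball about `π w` of radius the exponential of the
`n`-th Birkhoff sum of `a`, and its mass is the exponential of that of `b`. `IsGibbsCoding` records
exactly this, and `IsGibbsCoding.assouadDim_eq` is proved from it alone.

Lower bound: over `k` periods of a periodic word the Birkhoff sums are `k * A` and `k * B`, while
the errors stay bounded. An admissible exponent `s` therefore satisfies `B / A ≤ s` as `k → ∞`.

Upper bound: any finite word can be closed up to a periodic one at bounded cost. A bound `S` on the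
periodic ratios thus gives `S * a_n ≤ b_n` up to a constant for all Birkhoff sums, at every word.
Applied to the letters between the cylinders of sizes `R` and `r`, this yields the mass ratio bound
`(R / r) ^ S`.

The Gibbs property needs only one-step estimates whose errors are summable in the number of common
letters. For distances, conformality and the Hölder derivative compare one difference quotient with
`‖fderiv‖` (`exists_abs_log_dist_sub_log_norm_fderiv_le`), and telescoping gives
`exists_const_dist_codingMap`. For masses, separation turns invariance into a one-letter formula,
iterated in `IsInvariantMeasure.measure_cylinder_bounds`. Finally `log_periodProb` and
`log_periodDeriv` identify the periodic data with Birkhoff sums. -/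

/-! ### Words, cylinders and periodic closing. -/

theorem wordShift_iterate_apply {Λ : Type*} (w : ℕ → Λ) (n k : ℕ) :
    (wordShift^[n] w) k = w (k + n) := by
  induction n generalizing w with
  | zero => rfl
  | succ n ih => rw [Function.iterate_succ_apply, ih]; simp only [wordShift]; congr 1

theorem wordShift_mem_cylinder {Λ : Type*} {w v : ℕ → Λ} {n : ℕ}
    (h : v ∈ PiNat.cylinder w (n + 1)) : wordShift v ∈ PiNat.cylinder (wordShift w) n :=
  fun k hk => h (k + 1) (by omega)

theorem mem_cylinder_succ_iff {Λ : Type*} {w v : ℕ → Λ} {n : ℕ} :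
    v ∈ PiNat.cylinder w (n + 1) ↔
      v 0 = w 0 ∧ wordShift v ∈ PiNat.cylinder (wordShift w) n := by
  refine ⟨fun h => ⟨h 0 (by omega), wordShift_mem_cylinder h⟩, fun h k hk => ?_⟩
  cases k with
  | zero => exact h.1
  | succ k => exact h.2 k (by omega)

/-- The periodic word that repeats the first `n` letters of `w`. -/
def periodicExtension {Λ : Type*} (w : ℕ → Λ) (n : ℕ) : ℕ → Λ := fun k => w (k % n)

theorem periodicExtension_mem_cylinder {Λ : Type*} (w : ℕ → Λ) (n : ℕ) :
    periodicExtension w n ∈ PiNat.cylinder w n := fun k hk => by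
  simp [periodicExtension, Nat.mod_eq_of_lt hk]

theorem isPeriodicPt_periodicExtension {Λ : Type*} (w : ℕ → Λ) (n : ℕ) :
    Function.IsPeriodicPt wordShift n (periodicExtension w n) := by
  funext k
  simp [wordShift_iterate_apply, periodicExtension]

theorem Function.IsPeriodicPt.birkhoffSum_mul {α M : Type*} [AddCommMonoid M] {f : α → α} {n : ℕ}
    {x : α} (h : Function.IsPeriodicPt f n x) (u : α → M) (k : ℕ) :
    birkhoffSum f u (n * k) x = k • birkhoffSum f u n x := by
  induction k with
  | zero => simp
  | succ k ih =>
    rw [Nat.mul_succ, birkhoffSum_add, ih, succ_nsmul, (h.mul_const k).eq]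

theorem birkhoffSum_le_of_forall_le {α : Type*} {f : α → α} {u : α → ℝ} {c : ℝ}
    (h : ∀ x, u x ≤ c) (n : ℕ) (x : α) : birkhoffSum f u n x ≤ n * c := by
  simpa [birkhoffSum] using Finset.sum_le_sum fun k (_ : k ∈ Finset.range n) => h (f^[k] x)

/-! ### Assouad dimension from a Gibbs coding. -/

/-- `π` codes the support of the probability measure `μ` by infinite words in such a way that
cylinders are comparable to balls with logarithmic radii given by the Birkhoff sums of `a`, and the
logarithms of their measures are comparable to the Birkhoff sums of `b`. -/
structure IsGibbsCoding {Λ E : Type*} [PseudoMetricSpace E] [MeasurableSpace E]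
    (π : (ℕ → Λ) → E) (μ : Measure E) (a b : (ℕ → Λ) → ℝ) (C : ℝ) : Prop where
  distortion_fst : ∀ n w, ∀ v ∈ PiNat.cylinder w n,
    |birkhoffSum wordShift a n w - birkhoffSum wordShift a n v| ≤ C
  distortion_snd : ∀ n w, ∀ v ∈ PiNat.cylinder w n,
    |birkhoffSum wordShift b n w - birkhoffSum wordShift b n v| ≤ C
  dist_le : ∀ n w, ∀ v ∈ PiNat.cylinder w n,
    dist (π v) (π w) ≤ Real.exp (C + birkhoffSum wordShift a n w)
  mem_cylinder : ∀ n w v, dist (π v) (π w) < Real.exp (-C + birkhoffSum wordShift a n w) →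
    v ∈ PiNat.cylinder w n
  le_measure : ∀ n w, ENNReal.ofReal (Real.exp (-C + birkhoffSum wordShift b n w)) ≤
    μ (π '' PiNat.cylinder w n)
  measure_le : ∀ n w, μ (π '' PiNat.cylinder w n) ≤
    ENNReal.ofReal (Real.exp (C + birkhoffSum wordShift b n w))
  compl_range : μ (range π)ᶜ = 0
  support_subset : μ.support ⊆ range π
  lt_zero_snd : ∀ w, b w < 0
  fst_bound : ∃ θ M : ℝ, 0 < θ ∧ ∀ w, -M ≤ a w ∧ a w ≤ -θ

namespace IsGibbsCoding

variable {Λ E : Type*} [PseudoMetricSpace E] [MeasurableSpace E]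
  {π : (ℕ → Λ) → E} {μ : Measure E} {a b : (ℕ → Λ) → ℝ} {C : ℝ}

theorem measure_le_range (h : IsGibbsCoding π μ a b C) (s : Set E) (w : ℕ → Λ) :
    μ s ≤ μ (π '' PiNat.cylinder w 0) := by
  have : π '' PiNat.cylinder w 0 = range π := by simp [PiNat.cylinder_zero]
  rw [this]
  calc μ s ≤ μ (range π ∪ (range π)ᶜ) := measure_mono (by simp)
    _ ≤ μ (range π) + μ (range π)ᶜ := measure_union_le _ _
    _ = μ (range π) := by rw [h.compl_range, add_zero]

theorem const_nonneg (h : IsGibbsCoding π μ a b C) (w : ℕ → Λ) : 0 ≤ C :=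
  (abs_nonneg _).trans (h.distortion_fst 0 w w (PiNat.self_mem_cylinder w 0))

theorem exists_exp_le (h : IsGibbsCoding π μ a b C) (w : ℕ → Λ) (K : ℝ) {r : ℝ} (hr : 0 < r) :
    ∃ n, Real.exp (K + birkhoffSum wordShift a n w) ≤ r := by
  obtain ⟨θ, M, hθ, ha⟩ := h.fst_bound
  obtain ⟨n, hn⟩ := exists_nat_ge ((K - Real.log r) / θ)
  refine ⟨n, ?_⟩
  rw [← Real.le_log_iff_exp_le hr]
  have := birkhoffSum_le_of_forall_le (f := wordShift) (fun w => (ha w).2) n w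
  rw [div_le_iff₀ hθ] at hn
  linarith

theorem birkhoffSum_fst_neg (h : IsGibbsCoding π μ a b C) (w : ℕ → Λ) {n : ℕ} (hn : 0 < n) :
    birkhoffSum wordShift a n w < 0 := by
  obtain ⟨θ, M, hθ, ha⟩ := h.fst_bound
  have := birkhoffSum_le_of_forall_le (f := wordShift) (fun w => (ha w).2) n w
  have hn' : (0 : ℝ) < n := by exact_mod_cast hn
  nlinarith

theorem birkhoffSum_snd_neg (h : IsGibbsCoding π μ a b C) (w : ℕ → Λ) {n : ℕ} (hn : 0 < n) :
    birkhoffSum wordShift b n w < 0 :=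
  Finset.sum_neg (fun _ _ => h.lt_zero_snd _) (Finset.nonempty_range_iff.2 hn.ne')

theorem measure_closedBall_le (h : IsGibbsCoding π μ a b C) (w : ℕ → Λ) (n : ℕ) {r : ℝ}
    (hr : r < Real.exp (-C + birkhoffSum wordShift a n w)) :
    μ (Metric.closedBall (π w) r) ≤ μ (π '' PiNat.cylinder w n) := by
  have hsub : Metric.closedBall (π w) r ⊆ π '' PiNat.cylinder w n ∪ (range π)ᶜ := by
    intro x hx
    by_cases hxr : x ∈ range π
    · obtain ⟨v, rfl⟩ := hxr
      exact Or.inl ⟨v, h.mem_cylinder n w v (lt_of_le_of_lt hx hr), rfl⟩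
    · exact Or.inr hxr
  calc _ ≤ _ := measure_mono hsub
    _ ≤ _ := measure_union_le _ _
    _ = _ := by rw [h.compl_range, add_zero]

theorem le_measure_closedBall (h : IsGibbsCoding π μ a b C) (w : ℕ → Λ) (n : ℕ) {r : ℝ}
    (hr : Real.exp (C + birkhoffSum wordShift a n w) ≤ r) :
    μ (π '' PiNat.cylinder w n) ≤ μ (Metric.closedBall (π w) r) := by
  refine measure_mono ?_
  rintro _ ⟨v, hv, rfl⟩
  exact (h.dist_le n w v hv).trans hr

theorem mem_support (h : IsGibbsCoding π μ a b C) (w : ℕ → Λ) : π w ∈ μ.support := by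
  rw [Measure.mem_support_iff_forall]
  intro U hU
  obtain ⟨r, hr, hrU⟩ := Metric.nhds_basis_closedBall.mem_iff.1 hU
  obtain ⟨n, hn⟩ := h.exists_exp_le w C hr
  calc (0 : ℝ≥0∞) < ENNReal.ofReal (Real.exp (-C + birkhoffSum wordShift b n w)) := by
        simpa using Real.exp_pos _
    _ ≤ _ := h.le_measure n w
    _ ≤ _ := h.le_measure_closedBall w n hn
    _ ≤ _ := measure_mono hrU

/-- The Birkhoff ratio along a periodic word is a lower bound for every exponent that is admissible
in the definition of the Assouad dimension. -/
theorem div_le_of_admissible (h : IsGibbsCoding π μ a b C) {s C₀ : ℝ} (hC₀ : 0 < C₀)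
    (hs : ∀ x ∈ μ.support, ∀ r R : ℝ, 0 < r → r < R →
      μ (Metric.closedBall x R) ≤ ENNReal.ofReal (C₀ * (R / r) ^ s) * μ (Metric.closedBall x r))
    {w : ℕ → Λ} {n : ℕ} (hn : 0 < n) (hw : Function.IsPeriodicPt wordShift n w) :
    birkhoffSum wordShift b n w / birkhoffSum wordShift a n w ≤ s := by
  have ha := h.birkhoffSum_fst_neg w hn
  set A := birkhoffSum wordShift a n w
  set B := birkhoffSum wordShift b n w
  have hC := h.const_nonneg w
  -- A ball of radius `exp C` about `π w` already contains `range π`; the extra `1` gives `r < R`,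
  -- because `r ≤ 1`.
  set R : ℝ := Real.exp C + 1 with hR
  have hR0 : 0 < R := by positivity
  -- The right side does not depend on `k`, which forces `s * A ≤ B`.
  have key : ∀ k : ℕ, k * (s * A - B) ≤ 2 * C + Real.log C₀ + s * (Real.log R + C + 1) := by
    intro k
    have hak : birkhoffSum wordShift a (n * k) w = k * A := by
      rw [hw.birkhoffSum_mul, nsmul_eq_mul]
    have hbk : birkhoffSum wordShift b (n * k) w = k * B := by
      rw [hw.birkhoffSum_mul, nsmul_eq_mul]
    -- The `-1` supplies the strict inequality needed to place the ball inside a cylinder.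
    set r : ℝ := Real.exp (-C + k * A - 1) with hr
    have hr0 : 0 < r := Real.exp_pos _
    have hkA : (k : ℝ) * A ≤ 0 := mul_nonpos_of_nonneg_of_nonpos (Nat.cast_nonneg k) ha.le
    have hrR : r < R := by
      have h1 : r ≤ 1 := Real.exp_le_one_iff.2 (by linarith)
      have h2 := Real.exp_pos C
      linarith
    have h1 := hs (π w) (h.mem_support w) r R hr0 hrR
    have h2 : μ (Metric.closedBall (π w) r) ≤ ENNReal.ofReal (Real.exp (C + k * B)) := by
      rw [← hbk]
      refine (h.measure_closedBall_le w (n * k) ?_).trans (h.measure_le _ _)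
      rw [hak]
      exact Real.exp_lt_exp.2 (by linarith)
    have h3 : ENNReal.ofReal (Real.exp (-C)) ≤ μ (Metric.closedBall (π w) R) := by
      have := h.le_measure 0 w
      simp only [birkhoffSum_zero, add_zero] at this
      refine this.trans (h.le_measure_closedBall w 0 ?_)
      simp [hR]
    have hq : 0 < (R / r) ^ s := Real.rpow_pos_of_pos (by positivity) s
    have h4 : Real.exp (-C) ≤ C₀ * (R / r) ^ s * Real.exp (C + k * B) := by
      have := h3.trans (h1.trans (mul_le_mul_right h2 _))
      rw [← ENNReal.ofReal_mul (by positivity)] at this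
      exact (ENNReal.ofReal_le_ofReal_iff (by positivity)).1 this
    have h5 := Real.log_le_log (Real.exp_pos _) h4
    rw [Real.log_mul (by positivity) (by positivity), Real.log_mul (by positivity) hq.ne',
      Real.log_rpow (by positivity), Real.log_div hR0.ne' hr0.ne', Real.log_exp, Real.log_exp,
      Real.log_exp] at h5
    nlinarith
  have hle : s * A - B ≤ 0 := by
    by_contra! hpos
    obtain ⟨k, hk⟩ := exists_nat_gt
      ((2 * C + Real.log C₀ + s * (Real.log R + C + 1)) / (s * A - B))
    rw [div_lt_iff₀ hpos] at hk
    exact absurd (key k) (not_le.2 hk)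
  rw [div_le_iff_of_neg ha]
  linarith

/-- Repeating the first `n` letters of `w` gives a periodic word in the same `n`-cylinder, where the
inequality holds without error because `n` is a multiple of the minimal period. Returning to `w`
costs `C` for the sum of `b` and `S * C` for that of `a`. -/
theorem mul_birkhoffSum_le (h : IsGibbsCoding π μ a b C) {S : ℝ} (hS : 0 ≤ S)
    (hper : ∀ w ∈ Function.periodicPts (wordShift (Λ := Λ)),
      birkhoffSum wordShift b (Function.minimalPeriod wordShift w) w /
        birkhoffSum wordShift a (Function.minimalPeriod wordShift w) w ≤ S) (w : ℕ → Λ) (n : ℕ) :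
    S * birkhoffSum wordShift a n w - (1 + S) * C ≤ birkhoffSum wordShift b n w := by
  have hC := h.const_nonneg w
  rcases Nat.eq_zero_or_pos n with rfl | hn
  · simp only [birkhoffSum_zero]
    nlinarith
  set v := periodicExtension w n
  have hv : Function.IsPeriodicPt wordShift n v := isPeriodicPt_periodicExtension w n
  have hvp : v ∈ Function.periodicPts (wordShift (Λ := Λ)) := ⟨n, hn, hv⟩
  have hpos := Function.minimalPeriod_pos_of_mem_periodicPts hvp
  have h1 := hper v hvp
  rw [div_le_iff_of_neg (h.birkhoffSum_fst_neg v hpos)] at h1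
  have h2 : S * birkhoffSum wordShift a n v ≤ birkhoffSum wordShift b n v := by
    obtain ⟨k, hk⟩ := hv.minimalPeriod_dvd
    have hm := Function.isPeriodicPt_minimalPeriod wordShift v
    have e1 := hm.birkhoffSum_mul a k
    have e2 := hm.birkhoffSum_mul b k
    rw [← hk, nsmul_eq_mul] at e1 e2
    rw [e1, e2]
    have := mul_le_mul_of_nonneg_left h1 (Nat.cast_nonneg (α := ℝ) k)
    linarith
  have h3 := abs_le.1 (h.distortion_fst n w v (periodicExtension_mem_cylinder w n))
  have h4 := abs_le.1 (h.distortion_snd n w v (periodicExtension_mem_cylinder w n))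
  nlinarith

/-- A bound for the Birkhoff ratios along all periodic words is an admissible exponent in the
definition of the Assouad dimension. -/
theorem exists_admissible (h : IsGibbsCoding π μ a b C) {S : ℝ} (hS : 0 ≤ S)
    (hper : ∀ w ∈ Function.periodicPts (wordShift (Λ := Λ)),
      birkhoffSum wordShift b (Function.minimalPeriod wordShift w) w /
        birkhoffSum wordShift a (Function.minimalPeriod wordShift w) w ≤ S) :
    ∃ C₀ : ℝ, 0 < C₀ ∧ ∀ x ∈ μ.support, ∀ r R : ℝ, 0 < r → r < R →
      μ (Metric.closedBall x R) ≤
        ENNReal.ofReal (C₀ * (R / r) ^ S) * μ (Metric.closedBall x r) := by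
  obtain ⟨θ, M, hθ, ha⟩ := h.fst_bound
  -- The summands come from the two mass estimates, from periodic closing, and from comparing `log
  -- (R / r)` with a Birkhoff sum of `a`, where one surplus letter at each end costs `M`. The `+ 1`
  -- below makes the constant at least `1`, for `trivial_case`.
  set K := 2 * C + (1 + S) * C + S * (2 * C + 2 * M)
  refine ⟨Real.exp K + 1, by positivity, ?_⟩
  intro x hx r R hr hrR
  obtain ⟨w, rfl⟩ := h.support_subset hx
  have hR : 0 < R := hr.trans hrR
  have hq1 : 1 ≤ R / r := (one_le_div hr).2 hrR.le
  -- Here `m + 1` is the first length at which the inner radius drops to `R` or below. If that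
  -- already happens at length `0`, then `m = 0` works: the `0`-cylinder carries all the mass, and
  -- `a < 0`.
  have hm : ∃ m, Real.exp (-C + birkhoffSum wordShift a (m + 1) w) ≤ R ∧
      μ (Metric.closedBall (π w) R) ≤ μ (π '' PiNat.cylinder w m) := by
    classical
    have hex := h.exists_exp_le w (-C) hR
    cases hN : Nat.find hex with
    | zero =>
      refine ⟨0, ?_, h.measure_le_range _ w⟩
      have h0 := Nat.find_spec hex
      rw [hN] at h0
      refine le_trans (Real.exp_le_exp.2 ?_) h0
      simpa using (ha w).2.trans (by linarith)
    | succ m =>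
      have h0 := Nat.find_spec hex
      rw [hN] at h0
      exact ⟨m, h0, h.measure_closedBall_le w m
        (not_le.1 (Nat.find_min hex (by omega)))⟩
  obtain ⟨m, hmR, hmμ⟩ := hm
  have trivial_case : μ (Metric.closedBall (π w) R) ≤ μ (Metric.closedBall (π w) r) →
      μ (Metric.closedBall (π w) R) ≤
        ENNReal.ofReal ((Real.exp K + 1) * (R / r) ^ S) * μ (Metric.closedBall (π w) r) := by
    intro hle
    refine hle.trans (le_mul_of_one_le_left' ?_)
    rw [ENNReal.one_le_ofReal]
    exact one_le_mul_of_one_le_of_one_le (by linarith [Real.exp_pos K])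
      (Real.one_le_rpow hq1 hS)
  classical
  have hex := h.exists_exp_le w C hr
  have hn0 := Nat.find_spec hex
  have hnμ := h.le_measure_closedBall w _ hn0
  set n := Nat.find hex with hn
  -- When `r` is close to `R`, the cylinder inside the small ball can be the larger one; the two
  -- balls then have equal mass.
  rcases le_or_gt n m with hnm | hnm
  · exact trivial_case (hmμ.trans ((measure_mono (image_mono (PiNat.cylinder_anti w hnm))).trans hnμ))
  obtain ⟨l, hl⟩ : ∃ l, n = m + l + 1 := ⟨n - m - 1, by omega⟩
  have hrn : r < Real.exp (C + birkhoffSum wordShift a (m + l) w) :=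
    not_le.1 (Nat.find_min hex (by omega))
  have ea : birkhoffSum wordShift a n w = birkhoffSum wordShift a (m + l) w +
      a (wordShift^[m + l] w) := by rw [hl, birkhoffSum_succ]
  have ea' := birkhoffSum_add wordShift a m (l + 1) w
  have eb' := birkhoffSum_add wordShift b m (l + 1) w
  rw [← add_assoc, ← hl] at ea' eb'
  rw [birkhoffSum_succ] at hmR
  have hlogR := (Real.le_log_iff_exp_le hR).2 hmR
  have hlogr := (Real.log_lt_iff_lt_exp hr).2 hrn
  have hm1 := (ha (wordShift^[m] w)).1
  have hm2 := (ha (wordShift^[m + l] w)).1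
  have hT := h.mul_birkhoffSum_le hS hper (wordShift^[m] w) (l + 1)
  have hlog : -(2 * C + 2 * M) - birkhoffSum wordShift a (l + 1) (wordShift^[m] w) ≤
      Real.log (R / r) := by
    rw [Real.log_div hR.ne' hr.ne']
    linarith
  have hSlog := mul_le_mul_of_nonneg_left hlog hS
  calc μ (Metric.closedBall (π w) R) ≤ μ (π '' PiNat.cylinder w m) := hmμ
    _ ≤ ENNReal.ofReal (Real.exp (C + birkhoffSum wordShift b m w)) := h.measure_le m w
    _ ≤ ENNReal.ofReal (((Real.exp K + 1) * (R / r) ^ S) *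
          Real.exp (-C + birkhoffSum wordShift b n w)) := by
        refine ENNReal.ofReal_le_ofReal ?_
        have hq : Real.exp (S * Real.log (R / r)) = (R / r) ^ S := by
          rw [Real.rpow_def_of_pos (by positivity), mul_comm]
        calc Real.exp (C + birkhoffSum wordShift b m w)
            ≤ Real.exp (K + S * Real.log (R / r) + (-C + birkhoffSum wordShift b n w)) :=
              Real.exp_le_exp.2 (by simp only [K]; linarith)
          _ = Real.exp K * (R / r) ^ S * Real.exp (-C + birkhoffSum wordShift b n w) := by
              rw [Real.exp_add, Real.exp_add, hq]
          _ ≤ _ := by gcongr; linarith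
    _ = ENNReal.ofReal ((Real.exp K + 1) * (R / r) ^ S) *
          ENNReal.ofReal (Real.exp (-C + birkhoffSum wordShift b n w)) :=
        ENNReal.ofReal_mul (by positivity)
    _ ≤ _ := mul_le_mul_right ((h.le_measure n w).trans hnμ) _

theorem assouadDim_eq [Nonempty Λ] (h : IsGibbsCoding π μ a b C) :
    assouadDim μ = ⨆ w ∈ Function.periodicPts (wordShift (Λ := Λ)),
      ((birkhoffSum wordShift b (Function.minimalPeriod wordShift w) w /
        birkhoffSum wordShift a (Function.minimalPeriod wordShift w) w : ℝ) : EReal) := by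
  refine le_antisymm ?_ ?_
  · set T := ⨆ w ∈ Function.periodicPts (wordShift (Λ := Λ)),
      ((birkhoffSum wordShift b (Function.minimalPeriod wordShift w) w /
        birkhoffSum wordShift a (Function.minimalPeriod wordShift w) w : ℝ) : EReal) with hTdef
    have hle : ∀ w ∈ Function.periodicPts (wordShift (Λ := Λ)),
        ((birkhoffSum wordShift b (Function.minimalPeriod wordShift w) w /
          birkhoffSum wordShift a (Function.minimalPeriod wordShift w) w : ℝ) : EReal) ≤ T :=
      fun w hw => le_iSup₂ (f := fun (w : ℕ → Λ)
        (_ : w ∈ Function.periodicPts (wordShift (Λ := Λ))) =>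
        ((birkhoffSum wordShift b (Function.minimalPeriod wordShift w) w /
          birkhoffSum wordShift a (Function.minimalPeriod wordShift w) w : ℝ) : EReal)) w hw
    -- Positivity is needed because only exponents `s > 0` compete in `assouadDim`; a constant word
    -- already has a positive ratio.
    have hTpos : (0 : EReal) < T := by
      obtain ⟨i⟩ := ‹Nonempty Λ›
      have hw : (fun _ => i : ℕ → Λ) ∈ Function.periodicPts (wordShift (Λ := Λ)) :=
        ⟨1, one_pos, rfl⟩
      have hn := Function.minimalPeriod_pos_of_mem_periodicPts hw
      refine lt_of_lt_of_le ?_ (hle _ hw)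
      exact_mod_cast div_pos_of_neg_of_neg (h.birkhoffSum_snd_neg _ hn)
        (h.birkhoffSum_fst_neg _ hn)
    clear_value T
    induction T with
    | bot => simp at hTpos
    | top => exact le_top
    | coe S =>
      have hS : 0 < S := by exact_mod_cast hTpos
      exact iInf₂_le S ⟨hS, h.exists_admissible hS.le fun w hw => by exact_mod_cast hle w hw⟩
  · refine iSup₂_le fun w hw => le_iInf₂ fun s hs => ?_
    obtain ⟨-, C₀, hC₀, hadm⟩ := hs
    exact_mod_cast h.div_le_of_admissible hC₀ hadm
      (Function.minimalPeriod_pos_of_mem_periodicPts hw)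
      (Function.isPeriodicPt_minimalPeriod wordShift w)

end IsGibbsCoding

/-! ### Bounded distortion from summable variation. -/

section SummableVariation

variable {Λ : Type*} {ω : ℕ → ℝ} {u : (ℕ → Λ) → ℝ}

/-- After `k` shifts the words still share `n - k` letters, so the errors are `ω (n - 1), …, ω 0`.
-/
theorem abs_birkhoffSum_sub_le
    (hu : ∀ n w, ∀ v ∈ PiNat.cylinder w (n + 1), |u w - u v| ≤ ω n) (n : ℕ) :
    ∀ w, ∀ v ∈ PiNat.cylinder w n,
      |birkhoffSum wordShift u n w - birkhoffSum wordShift u n v| ≤ ∑ k ∈ Finset.range n, ω k := by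
  induction n with
  | zero => simp
  | succ n ih =>
    intro w v hv
    rw [birkhoffSum_succ', birkhoffSum_succ', Finset.sum_range_succ]
    have h1 := abs_le.1 (ih _ _ (wordShift_mem_cylinder hv))
    have h2 := abs_le.1 (hu n w v hv)
    exact abs_le.2 ⟨by linarith, by linarith⟩

/-- Telescoping one-step estimates along the orbit replaces a distortion estimate for the composed
maps. -/
theorem abs_log_dist_sub_birkhoffSum_le {E : Type*} [PseudoMetricSpace E] {π : (ℕ → Λ) → E}
    (hu : ∀ n w, ∀ v ∈ PiNat.cylinder w (n + 1), v ≠ w →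
      |Real.log (dist (π v) (π w)) - Real.log (dist (π (wordShift v)) (π (wordShift w))) - u w| ≤
        ω n) (n : ℕ) :
    ∀ w, ∀ v ∈ PiNat.cylinder w n, v ≠ w →
      |Real.log (dist (π v) (π w)) -
        Real.log (dist (π (wordShift^[n] v)) (π (wordShift^[n] w))) -
        birkhoffSum wordShift u n w| ≤ ∑ k ∈ Finset.range n, ω k := by
  induction n with
  | zero => simp
  | succ n ih =>
    intro w v hv hne
    have hne' : wordShift v ≠ wordShift w := by
      intro h
      refine hne (funext fun k => ?_)
      cases k with
      | zero => exact hv 0 (by omega)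
      | succ k => exact congrFun h k
    rw [birkhoffSum_succ', Finset.sum_range_succ]
    have h1 := abs_le.1 (ih _ _ (wordShift_mem_cylinder hv) hne')
    have h2 := abs_le.1 (hu n w v hv hne)
    simp only [Function.iterate_succ_apply]
    exact abs_le.2 ⟨by linarith, by linarith⟩

theorem summable_const_mul_rpow {c D K ε : ℝ} (hc0 : 0 ≤ c) (hc : c < 1) (hD : 0 ≤ D)
    (hε : 0 < ε) : Summable fun n : ℕ => K * (c ^ n * D) ^ ε := by
  have : (fun n : ℕ => K * (c ^ n * D) ^ ε) = fun n : ℕ => K * D ^ ε * (c ^ ε) ^ n := by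
    funext n
    rw [Real.mul_rpow (by positivity) hD, ← Real.rpow_natCast, ← Real.rpow_natCast,
      ← Real.rpow_mul hc0, ← Real.rpow_mul hc0, mul_comm (n : ℝ)]
    ring
  rw [this]
  exact (summable_geometric_of_lt_one (by positivity) (Real.rpow_lt_one hc0 hc hε)).mul_left _

end SummableVariation

/-! ### The coding map and its separation properties. -/

section Coding

variable {Λ E : Type*}

theorem wordMap_succ' (φ : Λ → E → E) (w : ℕ → Λ) (n : ℕ) :
    wordMap φ w (n + 1) = φ (w 0) ∘ wordMap φ (wordShift w) n := by
  induction n with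
  | zero => rfl
  | succ n ih =>
    rw [wordMap, ih]
    rfl

theorem IsLimitSet.mapsTo [TopologicalSpace E] {φ : Λ → E → E} {X F : Set E}
    (hF : IsLimitSet φ X F) (i : Λ) :
    MapsTo (φ i) F F := fun x hx => by
  rw [hF.eq_iUnion]
  exact mem_iUnion.2 ⟨i, x, hx, rfl⟩

theorem eq_codingMap [Nonempty E] {φ : Λ → E → E} {F : Set E}
    (hcode : ∀ w, ⋂ n : ℕ, wordMap φ w (n + 1) '' F = {codingMap φ F w})
    {w : ℕ → Λ} {x : E} (hx : ∀ n, x ∈ wordMap φ w (n + 1) '' F) : x = codingMap φ F w := by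
  have : x ∈ ⋂ n : ℕ, wordMap φ w (n + 1) '' F := mem_iInter.2 hx
  rwa [hcode] at this

variable [TopologicalSpace E] [Nonempty E] {φ : Λ → E → E} {X F : Set E}

theorem codingMap_mem_image (hF : IsLimitSet φ X F)
    (hcode : ∀ w, ⋂ n : ℕ, wordMap φ w (n + 1) '' F = {codingMap φ F w}) (w : ℕ → Λ) (n : ℕ) :
    codingMap φ F w ∈ wordMap φ w n '' F := by
  have h : codingMap φ F w ∈ ⋂ n : ℕ, wordMap φ w (n + 1) '' F := by rw [hcode]; rfl
  exact wordMap_image_subset hF w n (mem_iInter.1 h n)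

theorem codingMap_mem (hF : IsLimitSet φ X F)
    (hcode : ∀ w, ⋂ n : ℕ, wordMap φ w (n + 1) '' F = {codingMap φ F w}) (w : ℕ → Λ) :
    codingMap φ F w ∈ F := by
  simpa [wordMap] using codingMap_mem_image hF hcode w 0

theorem codingMap_eq_apply (hF : IsLimitSet φ X F)
    (hcode : ∀ w, ⋂ n : ℕ, wordMap φ w (n + 1) '' F = {codingMap φ F w}) (w : ℕ → Λ) :
    codingMap φ F w = φ (w 0) (codingMap φ F (wordShift w)) := by
  refine (eq_codingMap hcode fun n => ?_).symm
  rw [wordMap_succ', image_comp]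
  exact mem_image_of_mem _ (codingMap_mem_image hF hcode _ n)

/-- Each point of `F` has a preimage in `F` under some map; iterating a choice of preimages reads
off a code. -/
theorem range_codingMap (hF : IsLimitSet φ X F)
    (hcode : ∀ w, ⋂ n : ℕ, wordMap φ w (n + 1) '' F = {codingMap φ F w}) :
    range (codingMap φ F) = F := by
  refine Subset.antisymm (range_subset_iff.2 (codingMap_mem hF hcode)) fun x hx => ?_
  have hpre : ∀ x : F, ∃ q : Λ × F, φ q.1 q.2 = x := by
    rintro ⟨x, hx⟩
    have hx' := hx
    rw [hF.eq_iUnion] at hx'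
    obtain ⟨i, y, hy, rfl⟩ := mem_iUnion.1 hx'
    exact ⟨(i, ⟨y, hy⟩), rfl⟩
  choose q hq using hpre
  let s : ℕ → F := fun n => (fun y => (q y).2)^[n] ⟨x, hx⟩
  let w : ℕ → Λ := fun n => (q (s n)).1
  have hs : ∀ n, wordMap φ w n (s n) = x := by
    intro n
    induction n with
    | zero => rfl
    | succ n ih =>
      have : φ (w n) (s (n + 1)) = s n := by
        simp only [s, w, Function.iterate_succ_apply']
        exact hq _
      rw [wordMap, Function.comp_apply, this, ih]
  exact ⟨w, (eq_codingMap hcode fun n => ⟨s (n + 1), (s (n + 1)).2, hs (n + 1)⟩).symm⟩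

theorem codingMap_image_cylinder_succ (hF : IsLimitSet φ X F)
    (hcode : ∀ w, ⋂ n : ℕ, wordMap φ w (n + 1) '' F = {codingMap φ F w}) (w : ℕ → Λ) (n : ℕ) :
    codingMap φ F '' PiNat.cylinder w (n + 1) =
      φ (w 0) '' (codingMap φ F '' PiNat.cylinder (wordShift w) n) := by
  ext x
  simp only [mem_image, exists_exists_and_eq_and]
  constructor
  · rintro ⟨v, hv, rfl⟩
    rw [mem_cylinder_succ_iff] at hv
    exact ⟨_, hv.2, by rw [codingMap_eq_apply hF hcode v, hv.1]⟩
  · rintro ⟨v, hv, rfl⟩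
    let u : ℕ → Λ := fun k => Nat.casesOn k (w 0) v
    have hu : wordShift u = v := rfl
    exact ⟨u, mem_cylinder_succ_iff.2 ⟨rfl, hv⟩, codingMap_eq_apply hF hcode u⟩

theorem codingMap_injective (hF : IsLimitSet φ X F)
    (hcode : ∀ w, ⋂ n : ℕ, wordMap φ w (n + 1) '' F = {codingMap φ F w})
    (hsep : StrongSeparation φ F) (hinj : ∀ i, InjOn (φ i) F) :
    Function.Injective (codingMap φ F) := by
  have step : ∀ w v, codingMap φ F w = codingMap φ F v →
      w 0 = v 0 ∧ codingMap φ F (wordShift w) = codingMap φ F (wordShift v) := by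
    intro w v h
    rw [codingMap_eq_apply hF hcode w, codingMap_eq_apply hF hcode v] at h
    have hw := codingMap_mem hF hcode (wordShift w)
    have hv := codingMap_mem hF hcode (wordShift v)
    have h0 : w 0 = v 0 := by
      by_contra hne
      refine disjoint_left.1 (hsep _ _ hne) (mem_image_of_mem _ hw) ?_
      rw [h]
      exact mem_image_of_mem _ hv
    refine ⟨h0, ?_⟩
    rw [← h0] at h
    exact hinj _ hw hv h
  intro w v h
  funext n
  induction n generalizing w v with
  | zero => exact (step w v h).1
  | succ n ih => exact ih (step w v h).2

end Coding

section MetricCoding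

variable {Λ E : Type*} [MetricSpace E] [Nonempty E] {φ : Λ → E → E} {X F : Set E}

theorem dist_codingMap_le (hF : IsLimitSet φ X F)
    (hcode : ∀ w, ⋂ n : ℕ, wordMap φ w (n + 1) '' F = {codingMap φ F w}) {c : ℝ≥0}
    (hlip : ∀ i, LipschitzOnWith c (φ i) F) (n : ℕ) :
    ∀ w, ∀ v ∈ PiNat.cylinder w n,
      dist (codingMap φ F v) (codingMap φ F w) ≤ (c : ℝ) ^ n * Metric.diam F := by
  induction n with
  | zero =>
    intro w v _
    simpa using Metric.dist_le_diam_of_mem hF.isCompact.isBounded (codingMap_mem hF hcode v)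
      (codingMap_mem hF hcode w)
  | succ n ih =>
    intro w v hv
    rw [mem_cylinder_succ_iff] at hv
    rw [codingMap_eq_apply hF hcode w, codingMap_eq_apply hF hcode v, hv.1]
    refine ((hlip (w 0)).dist_le_mul _ (codingMap_mem hF hcode _) _
      (codingMap_mem hF hcode _)).trans ?_
    rw [pow_succ', mul_assoc]
    exact mul_le_mul_of_nonneg_left (ih _ _ hv.2) c.coe_nonneg

theorem exists_separation [Finite Λ] (hF : IsLimitSet φ X F)
    (hcode : ∀ w, ⋂ n : ℕ, wordMap φ w (n + 1) '' F = {codingMap φ F w})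
    (hsep : StrongSeparation φ F) (hcont : ∀ i, ContinuousOn (φ i) F) :
    ∃ δ : ℝ, 0 < δ ∧ ∀ w v : ℕ → Λ, v 0 ≠ w 0 →
      δ ≤ dist (codingMap φ F v) (codingMap φ F w) := by
  have hpair : ∀ i j : Λ, ∃ δ : ℝ, 0 < δ ∧ (i ≠ j → ∀ x ∈ φ i '' F, ∀ y ∈ φ j '' F,
      δ ≤ dist x y) := by
    intro i j
    by_cases hij : i = j
    · exact ⟨1, one_pos, fun h => absurd hij h⟩
    · obtain ⟨r, hr, h⟩ := Metric.exists_pos_forall_lt_edist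
        (hF.isCompact.image_of_continuousOn (hcont i))
        (hF.isCompact.image_of_continuousOn (hcont j)).isClosed (hsep i j hij)
      refine ⟨r, hr, fun _ x hx y hy => ?_⟩
      have := h x hx y hy
      rw [edist_nndist] at this
      exact_mod_cast this.le
  choose δ hδ hδ' using hpair
  rcases isEmpty_or_nonempty Λ with hΛ | hΛ
  · exact ⟨1, one_pos, fun w => (hΛ.false (w 0)).elim⟩
  obtain ⟨q, hq⟩ := Finite.exists_min fun q : Λ × Λ => δ q.1 q.2
  refine ⟨δ q.1 q.2, hδ _ _, fun w v hne => (hq (v 0, w 0)).trans (hδ' _ _ hne _ ?_ _ ?_)⟩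
  · rw [codingMap_eq_apply hF hcode v]
    exact mem_image_of_mem _ (codingMap_mem hF hcode _)
  · rw [codingMap_eq_apply hF hcode w]
    exact mem_image_of_mem _ (codingMap_mem hF hcode _)

end MetricCoding

/-- The comparison of balls with cylinders for codings whose logarithmic contraction rates have
summable variation. -/
theorem exists_const_dist_codingMap {Λ E : Type*} [MetricSpace E] {π : (ℕ → Λ) → E}
    (hinj : Function.Injective π) {ω : ℕ → ℝ} (hω0 : ∀ n, 0 ≤ ω n) (hω : Summable ω)
    {a : (ℕ → Λ) → ℝ} (ha : ∀ w, a w ≤ 0)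
    (hu : ∀ n w, ∀ v ∈ PiNat.cylinder w (n + 1), v ≠ w →
      |Real.log (dist (π v) (π w)) - Real.log (dist (π (wordShift v)) (π (wordShift w))) - a w| ≤
        ω n)
    {D δ : ℝ} (hD : ∀ w v, dist (π v) (π w) ≤ D) (hδ : 0 < δ)
    (hsep : ∀ w v, v 0 ≠ w 0 → δ ≤ dist (π v) (π w)) :
    ∃ C : ℝ, (∀ n w, ∀ v ∈ PiNat.cylinder w n,
      dist (π v) (π w) ≤ Real.exp (C + birkhoffSum wordShift a n w)) ∧
      ∀ n w v, dist (π v) (π w) < Real.exp (-C + birkhoffSum wordShift a n w) →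
        v ∈ PiNat.cylinder w n := by
  set W := ∑' k, ω k
  have hW : ∀ n, ∑ k ∈ Finset.range n, ω k ≤ W := fun n => hω.sum_le_tsum _ fun k _ => hω0 k
  -- `W` is the total distortion; after the shifts the distance is at most `D`, and at least `δ` if
  -- the next letters differ.
  refine ⟨max (W + Real.log D) (W - Real.log δ), fun n w v hv => ?_, fun n w v hlt => ?_⟩
  · rcases eq_or_ne v w with rfl | hne
    · simpa using (Real.exp_pos _).le
    · have hpos : 0 < dist (π v) (π w) := dist_pos.2 (hinj.ne hne)
      have hne' : wordShift^[n] v ≠ wordShift^[n] w := by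
        intro h
        refine hne (funext fun k => ?_)
        rcases lt_or_ge k n with hk | hk
        · exact hv k hk
        · have := congrFun h (k - n)
          simpa [wordShift_iterate_apply, Nat.sub_add_cancel hk] using this
      have hpos' := dist_pos.2 (hinj.ne hne')
      have h1 := abs_le.1 (abs_log_dist_sub_birkhoffSum_le hu n w v hv hne)
      have h2 := Real.log_le_log hpos' (hD (wordShift^[n] w) (wordShift^[n] v))
      rw [← Real.log_le_iff_le_exp hpos]
      have h3 := le_max_left (W + Real.log D) (W - Real.log δ)
      linarith [hW n]
  · by_contra hv
    have hex : ∃ k, k < n ∧ v k ≠ w k := by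
      by_contra! h
      exact hv h
    classical
    -- At the first disagreement `k < n` the shifted points are `δ`-separated, and the Birkhoff sum
    -- at `k` is at least the one at `n` because `a ≤ 0`.
    set k := Nat.find hex
    obtain ⟨hkn, hk⟩ := Nat.find_spec hex
    have hvk : v ∈ PiNat.cylinder w k := fun j hj => by
      by_contra hne
      exact Nat.find_min hex hj ⟨hj.trans hkn, hne⟩
    have hne : v ≠ w := fun h => hk (congrFun h _)
    have hpos : 0 < dist (π v) (π w) := dist_pos.2 (hinj.ne hne)
    have h1 := abs_le.1 (abs_log_dist_sub_birkhoffSum_le hu k w v hvk hne)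
    have h2 := Real.log_le_log hδ (hsep (wordShift^[k] w) (wordShift^[k] v)
      (by simpa [wordShift_iterate_apply] using hk))
    have h3 : birkhoffSum wordShift a n w ≤ birkhoffSum wordShift a k w := by
      obtain ⟨l, hl⟩ := Nat.exists_eq_add_of_lt hkn
      rw [hl, add_assoc, birkhoffSum_add]
      have := birkhoffSum_le_of_forall_le (f := wordShift) ha (l + 1) (wordShift^[k] w)
      simp only [mul_zero] at this
      linarith
    rw [← Real.log_lt_iff_lt_exp hpos] at hlt
    have h4 := le_max_right (W + Real.log D) (W - Real.log δ)
    linarith [hW k]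

/-! ### Difference quotients of conformal maps. -/

theorem abs_log_sub_log_le {m s t : ℝ} (hm : 0 < m) (hs : m ≤ s) (ht : m ≤ t) :
    |Real.log s - Real.log t| ≤ |s - t| / m := by
  have key : ∀ {s t : ℝ}, m ≤ s → m ≤ t → Real.log s - Real.log t ≤ |s - t| / m := by
    intro s t hs ht
    have hs0 := hm.trans_le hs
    have ht0 := hm.trans_le ht
    rw [← Real.log_div hs0.ne' ht0.ne']
    calc Real.log (s / t) ≤ s / t - 1 := Real.log_le_sub_one_of_pos (div_pos hs0 ht0)
      _ = (s - t) / t := by field_simp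
      _ ≤ |s - t| / t := by gcongr; exact le_abs_self _
      _ ≤ |s - t| / m := by gcongr
  refine abs_le.2 ⟨?_, key hs ht⟩
  have := key ht hs
  rw [abs_sub_comm] at this
  linarith

section Conformal

variable {E : Type*} [NormedAddCommGroup E] [NormedSpace ℝ E]

theorem ConformalAt.norm_fderiv_apply {f : E → E} {x : E} (h : ConformalAt f x) (v : E) :
    ‖fderiv ℝ f x v‖ = ‖fderiv ℝ f x‖ * ‖v‖ := by
  rcases subsingleton_or_nontrivial E with hE | hE
  · simp [Subsingleton.elim v 0]
  obtain ⟨c, -, li, hli⟩ := conformalAt_iff_isConformalMap_fderiv.1 h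
  have hv : ∀ v, ‖fderiv ℝ f x v‖ = |c| * ‖v‖ := fun v => by
    rw [hli]
    simp [norm_smul]
  rw [hv, ContinuousLinearMap.homothety_norm _ hv]

theorem ConformalAt.norm_fderiv_pos [Nontrivial E] {f : E → E} {x : E} (h : ConformalAt f x) :
    0 < ‖fderiv ℝ f x‖ := by
  obtain ⟨c, hc, li, hli⟩ := conformalAt_iff_isConformalMap_fderiv.1 h
  have hv : ∀ v, ‖fderiv ℝ f x v‖ = |c| * ‖v‖ := fun v => by
    rw [hli]
    simp [norm_smul]
  rw [ContinuousLinearMap.homothety_norm _ hv]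
  exact abs_pos.2 hc

variable {f : E → E} {Ω F : Set E}

/-- First order Taylor estimate with a Hölder continuous derivative, uniform on compact sets. -/
theorem exists_norm_sub_sub_fderiv_le [ProperSpace E] (hΩ : IsOpen Ω) (hF : IsCompact F)
    (hFΩ : F ⊆ Ω) (hf : ContDiffOn ℝ 1 f Ω)
    (hol : ∃ ε : ℝ≥0, 0 < ε ∧ ∀ K ⊆ Ω, IsCompact K → ∃ C : ℝ≥0, HolderOnWith C ε (fderiv ℝ f) K) :
    ∃ C ε δ : ℝ, 0 ≤ C ∧ 0 < ε ∧ 0 < δ ∧ ∀ x ∈ F, ∀ y, dist y x ≤ δ →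
      ‖f y - f x - fderiv ℝ f x (y - x)‖ ≤ C * dist y x ^ ε * dist y x := by
  obtain ⟨ε, hε, hol⟩ := hol
  obtain ⟨δ, hδ, hδΩ⟩ := hF.exists_cthickening_subset_open hΩ hFΩ
  obtain ⟨C, hC⟩ := hol _ hδΩ hF.cthickening
  refine ⟨C, ε, δ, C.coe_nonneg, by exact_mod_cast hε, hδ, fun x hx y hy => ?_⟩
  have hsub : Metric.closedBall x (dist y x) ⊆ Metric.cthickening δ F :=
    (Metric.closedBall_subset_closedBall hy).trans (Metric.closedBall_subset_cthickening hx δ)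
  rw [dist_eq_norm y x]
  refine Convex.norm_image_sub_le_of_norm_fderiv_le' (𝕜 := ℝ) (s := Metric.closedBall x (dist y x))
    (fun z hz => ?_) (fun z hz => ?_) (convex_closedBall _ _) ?_ ?_
  · exact (hf.differentiableOn one_ne_zero z (hδΩ (hsub hz))).differentiableAt
      (hΩ.mem_nhds (hδΩ (hsub hz)))
  · rw [← dist_eq_norm, ← dist_eq_norm]
    refine (hC.dist_le (hsub hz) (hsub (by simp))).trans ?_
    gcongr
    exact hz
  · simp
  · simp

/-- For close points, a similarity turns the Taylor estimate into one for distances. Beyond distance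
`δ` only the crude bound `M` is available; `M / δ ^ ε` absorbs it. -/
theorem exists_abs_dist_div_sub_norm_fderiv_le [ProperSpace E] (hΩ : IsOpen Ω) (hF : IsCompact F)
    (hFΩ : F ⊆ Ω) (hf : ContDiffOn ℝ 1 f Ω)
    (hol : ∃ ε : ℝ≥0, 0 < ε ∧ ∀ K ⊆ Ω, IsCompact K → ∃ C : ℝ≥0, HolderOnWith C ε (fderiv ℝ f) K)
    (hconf : ∀ x ∈ Ω, ConformalAt f x) {c : ℝ≥0} (hlip : LipschitzOnWith c f F) :
    ∃ K ε : ℝ, 0 ≤ K ∧ 0 < ε ∧ ∀ x ∈ F, ∀ y ∈ F, y ≠ x →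
      |dist (f y) (f x) / dist y x - ‖fderiv ℝ f x‖| ≤ K * dist y x ^ ε := by
  obtain ⟨C, ε, δ, hC, hε, hδ, h⟩ := exists_norm_sub_sub_fderiv_le hΩ hF hFΩ hf hol
  obtain ⟨G, hG⟩ := hF.exists_bound_of_continuousOn
    ((hf.continuousOn_fderiv_of_isOpen hΩ le_rfl).mono hFΩ)
  have hG' : ∀ x ∈ F, 0 ≤ max G 0 ∧ ‖fderiv ℝ f x‖ ≤ max G 0 :=
    fun x hx => ⟨le_max_right _ _, (hG x hx).trans (le_max_left _ _)⟩
  set M := c + max G 0 with hM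
  have hM0 : 0 ≤ M := add_nonneg c.coe_nonneg (le_max_right _ _)
  refine ⟨C + M / δ ^ ε, ε, by positivity, hε, fun x hx y hy hne => ?_⟩
  have ht : 0 < dist y x := dist_pos.2 hne
  have htε : 0 ≤ dist y x ^ ε := by positivity
  rcases le_or_gt (dist y x) δ with hle | hlt
  · have h1 := (abs_norm_sub_norm_le _ _).trans (h x hx y hle)
    rw [(hconf x (hFΩ hx)).norm_fderiv_apply, ← dist_eq_norm, ← dist_eq_norm] at h1
    have h2 : dist (f y) (f x) / dist y x - ‖fderiv ℝ f x‖ =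
        (dist (f y) (f x) - ‖fderiv ℝ f x‖ * dist y x) / dist y x := by field_simp
    rw [h2, abs_div, abs_of_pos ht, div_le_iff₀ ht]
    refine h1.trans ?_
    gcongr
    linarith [show 0 ≤ M / δ ^ ε by positivity]
  · have h1 : dist (f y) (f x) / dist y x ≤ c := by
      rw [div_le_iff₀ ht]
      exact hlip.dist_le_mul y hy x hx
    have h2 : 0 ≤ dist (f y) (f x) / dist y x := by positivity
    have h3 : |dist (f y) (f x) / dist y x - ‖fderiv ℝ f x‖| ≤ M := by
      have := hG' x hx
      exact abs_le.2 ⟨by linarith [c.coe_nonneg], by linarith [norm_nonneg (fderiv ℝ f x)]⟩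
    refine h3.trans ?_
    have h4 : M ≤ M / δ ^ ε * dist y x ^ ε := by
      have : δ ^ ε ≤ dist y x ^ ε := by gcongr
      rw [div_mul_eq_mul_div, le_div_iff₀ (by positivity)]
      gcongr
    have : 0 ≤ C * dist y x ^ ε := by positivity
    linarith

theorem exists_le_norm_fderiv [Nontrivial E] (hΩ : IsOpen Ω) (hF : IsCompact F)
    (hFΩ : F ⊆ Ω) (hf : ContDiffOn ℝ 1 f Ω) (hconf : ∀ x ∈ Ω, ConformalAt f x) :
    ∃ m : ℝ, 0 < m ∧ ∀ x ∈ F, m ≤ ‖fderiv ℝ f x‖ := by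
  rcases F.eq_empty_or_nonempty with rfl | hne
  · exact ⟨1, one_pos, by simp⟩
  obtain ⟨x, hx, hmin⟩ := hF.exists_isMinOn hne
    ((hf.continuousOn_fderiv_of_isOpen hΩ le_rfl).mono hFΩ).norm
  exact ⟨_, (hconf x (hFΩ hx)).norm_fderiv_pos, fun y hy => hmin hy⟩

theorem exists_le_dist_image {E' : Type*} [MetricSpace E'] {f : E' → E'} {F : Set E'}
    (hF : IsCompact F) (hf : ContinuousOn f F) (hinj : InjOn f F) {t : ℝ} (ht : 0 < t) :
    ∃ m : ℝ, 0 < m ∧ ∀ x ∈ F, ∀ y ∈ F, t ≤ dist y x → m ≤ dist (f y) (f x) := by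
  set S : Set (E' × E') := F ×ˢ F ∩ {q | t ≤ dist q.1 q.2}
  have hS : IsCompact S := (hF.prod hF).inter_right (isClosed_le continuous_const continuous_dist)
  have hcont : ContinuousOn (fun q : E' × E' => dist (f q.1) (f q.2)) S :=
    continuous_dist.comp_continuousOn ((hf.comp continuous_fst.continuousOn fun q hq => hq.1.1).prodMk
      (hf.comp continuous_snd.continuousOn fun q hq => hq.1.2))
  rcases S.eq_empty_or_nonempty with hemp | hne
  · refine ⟨1, one_pos, fun x hx y hy hxy => ?_⟩
    have : ((y, x) : E' × E') ∈ S := ⟨⟨hy, hx⟩, hxy⟩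
    simp [hemp] at this
  · obtain ⟨q, hq, hmin⟩ := hS.exists_isMinOn hne hcont
    refine ⟨_, dist_pos.2 (hinj.ne hq.1.1 hq.1.2 ?_), fun x hx y hy hxy =>
      hmin (show ((y, x) : E' × E') ∈ S from ⟨⟨hy, hx⟩, hxy⟩)⟩
    exact dist_pos.1 (ht.trans_le hq.2)

/-- The logarithm of the difference quotients of a conformal `C^{1+ε}` map on a compact set is
controlled by the derivative, with a Hölder error term. -/
theorem exists_abs_log_dist_sub_log_norm_fderiv_le [ProperSpace E] [Nontrivial E] (hΩ : IsOpen Ω)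
    (hF : IsCompact F) (hFΩ : F ⊆ Ω) (hf : ContDiffOn ℝ 1 f Ω)
    (hol : ∃ ε : ℝ≥0, 0 < ε ∧ ∀ K ⊆ Ω, IsCompact K → ∃ C : ℝ≥0, HolderOnWith C ε (fderiv ℝ f) K)
    (hconf : ∀ x ∈ Ω, ConformalAt f x) {c : ℝ≥0} (hlip : LipschitzOnWith c f F)
    (hinj : InjOn f F) :
    ∃ K ε : ℝ, 0 ≤ K ∧ 0 < ε ∧ ∀ x ∈ F, ∀ y ∈ F, y ≠ x →
      |Real.log (dist (f y) (f x)) - Real.log (dist y x) - Real.log ‖fderiv ℝ f x‖| ≤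
        K * dist y x ^ ε := by
  obtain ⟨K, ε, hK, hε, h⟩ := exists_abs_dist_div_sub_norm_fderiv_le hΩ hF hFΩ hf hol hconf hlip
  obtain ⟨m, hm, hmle⟩ := exists_le_norm_fderiv hΩ hF hFΩ hf hconf
  -- Below distance `t` the error is at most `m / 2`, so the quotient is at least `m / 2`; beyond
  -- `t`, injectivity and compactness bound it below. Hence `log` is applied on `[l, ∞)`, where it
  -- is Lipschitz. `K + 1` avoids dividing by zero.
  set t := (m / (2 * (K + 1))) ^ ε⁻¹ with ht
  have ht0 : 0 < t := by positivity
  obtain ⟨m', hm', hm'le⟩ := exists_le_dist_image hF hlip.continuousOn hinj ht0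
  set D := Metric.diam F + 1
  have hD : 0 < D := by positivity
  set l := min (m / 2) (m' / D)
  have hl : 0 < l := lt_min (by positivity) (by positivity)
  refine ⟨K / l, ε, by positivity, hε, fun x hx y hy hne => ?_⟩
  have hd : 0 < dist y x := dist_pos.2 hne
  have hfd : 0 < dist (f y) (f x) := dist_pos.2 (hinj.ne hy hx hne)
  have hxy := h x hx y hy hne
  have hratio : l ≤ dist (f y) (f x) / dist y x := by
    rcases le_or_gt t (dist y x) with hle | hlt
    · refine (min_le_right _ _).trans ?_
      have h1 := Metric.dist_le_diam_of_mem hF.isBounded hy hx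
      have h2 := hm'le x hx y hy hle
      gcongr
      linarith
    · refine (min_le_left _ _).trans ?_
      have h1 : dist y x ^ ε ≤ m / (2 * (K + 1)) := by
        calc dist y x ^ ε ≤ t ^ ε := by gcongr
          _ = _ := by rw [ht, ← Real.rpow_mul (by positivity), inv_mul_cancel₀ hε.ne',
            Real.rpow_one]
      have h2 : K * dist y x ^ ε ≤ m / 2 := by
        calc K * dist y x ^ ε ≤ (K + 1) * (m / (2 * (K + 1))) := by gcongr; linarith
          _ = m / 2 := by field_simp
      have h3 := (abs_le.1 hxy).1
      have h4 := hmle x hx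
      linarith
  rw [← Real.log_div hfd.ne' hd.ne']
  refine (abs_log_sub_log_le hl hratio ?_).trans ?_
  · exact (min_le_left _ _).trans (by linarith [hmle x hx])
  · rw [div_mul_eq_mul_div]
    gcongr

end Conformal

/-! ### Summable error bounds from Hölder estimates. -/

theorem exists_abs_log_sub_log_le_of_holder {E : Type*} [MetricSpace E] {p : E → ℝ} {X : Set E}
    (hX : IsCompact X) (hol : ∃ α C : ℝ≥0, 0 < α ∧ HolderOnWith C α p X)
    (hpos : ∀ x ∈ X, 0 < p x) :
    ∃ K ε : ℝ, 0 ≤ K ∧ 0 < ε ∧ ∀ x ∈ X, ∀ y ∈ X, y ≠ x →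
      |Real.log (p y) - Real.log (p x)| ≤ K * dist y x ^ ε := by
  obtain ⟨α, C, hα, hC⟩ := hol
  rcases X.eq_empty_or_nonempty with rfl | hne
  · exact ⟨0, 1, le_rfl, one_pos, by simp⟩
  obtain ⟨z, hz, hmin⟩ := hX.exists_isMinOn hne (hC.continuousOn hα)
  have hm := hpos z hz
  refine ⟨C / p z, α, by positivity, by exact_mod_cast hα, fun x hx y hy _ => ?_⟩
  refine (abs_log_sub_log_le hm (hmin hy) (hmin hx)).trans ?_
  rw [div_mul_eq_mul_div, ← Real.dist_eq]
  gcongr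
  exact hC.dist_le hy hx

/-- The Hölder exponents may depend on the letter; summing the geometric bounds over the finite
alphabet gives one common error sequence. -/
theorem exists_summable_bound {Λ E : Type*} [Fintype Λ] [MetricSpace E] {F : Set E}
    {Φ : Λ → E → E → ℝ}
    (h : ∀ i, ∃ K ε : ℝ, 0 ≤ K ∧ 0 < ε ∧ ∀ x ∈ F, ∀ y ∈ F, y ≠ x → |Φ i y x| ≤ K * dist y x ^ ε)
    {c D : ℝ} (hc0 : 0 ≤ c) (hc : c < 1) (hD : 0 ≤ D) :
    ∃ ω : ℕ → ℝ, (∀ n, 0 ≤ ω n) ∧ Summable ω ∧ ∀ n i, ∀ x ∈ F, ∀ y ∈ F, y ≠ x →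
      dist y x ≤ c ^ n * D → |Φ i y x| ≤ ω n := by
  choose K ε hK hε h using h
  have hnn : ∀ n i, 0 ≤ K i * (c ^ n * D) ^ ε i := fun n i => mul_nonneg (hK i) (by positivity)
  refine ⟨fun n => ∑ i, K i * (c ^ n * D) ^ ε i, fun n => Finset.sum_nonneg fun i _ => hnn n i,
    summable_sum fun i _ => summable_const_mul_rpow hc0 hc hD (hε i),
    fun n i x hx y hy hne hdist => ?_⟩
  calc |Φ i y x| ≤ K i * dist y x ^ ε i := h i x hx y hy hne
    _ ≤ K i * (c ^ n * D) ^ ε i := by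
        have := hK i
        have := (hε i).le
        gcongr
    _ ≤ _ := Finset.single_le_sum (f := fun i => K i * (c ^ n * D) ^ ε i)
        (fun i _ => hnn n i) (Finset.mem_univ i)

/-! ### The invariant measure on cylinders. -/

theorem IsPlaceDependentProb.continuousOn {Λ E : Type*} [Fintype Λ] [PseudoEMetricSpace E]
    {p : Λ → E → ℝ} {X : Set E} (hp : IsPlaceDependentProb p X) (i : Λ) :
    ContinuousOn (p i) X := by
  obtain ⟨α, C, hα, h⟩ := hp.holder i
  exact h.continuousOn hα

theorem isCompact_codingMap_image_cylinder {Λ E : Type*} [TopologicalSpace E] [Nonempty E]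
    {φ : Λ → E → E} {X F : Set E} (hF : IsLimitSet φ X F)
    (hcode : ∀ w, ⋂ n : ℕ, wordMap φ w (n + 1) '' F = {codingMap φ F w})
    (hcont : ∀ i, ContinuousOn (φ i) F) (n : ℕ) :
    ∀ w, IsCompact (codingMap φ F '' PiNat.cylinder w n) := by
  induction n with
  | zero =>
    intro w
    rw [PiNat.cylinder_zero, image_univ, range_codingMap hF hcode]
    exact hF.isCompact
  | succ n ih =>
    intro w
    rw [codingMap_image_cylinder_succ hF hcode]
    refine (ih _).image_of_continuousOn ((hcont _).mono ?_)
    rintro _ ⟨v, -, rfl⟩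
    exact codingMap_mem hF hcode v

section InvariantMeasure

variable {Λ E : Type*} [Fintype Λ] [MetricSpace E] [MeasurableSpace E] [BorelSpace E]
  {φ : Λ → E → E} {p : Λ → E → ℝ} {X F : Set E} {μ : Measure E}

/-- Every map sends the `δ`-neighbourhood of `F` into the `c * δ`-neighbourhood, and the weights sum
to one, so invariance loses no mass. Iteration pushes all the mass onto `F`. -/
theorem IsInvariantMeasure.measure_cthickening_le (hX : IsCompact X) (hF : IsLimitSet φ X F)
    (hmaps : ∀ i, MapsTo (φ i) X X) {c : ℝ≥0} (hlip : ∀ i, LipschitzOnWith c (φ i) X)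
    (hp : IsPlaceDependentProb p X) (hμ : IsInvariantMeasure φ p X μ) {δ : ℝ} (hδ : 0 ≤ δ) :
    μ (X ∩ Metric.cthickening δ F) ≤ μ (X ∩ Metric.cthickening (c * δ) F) := by
  have hmeas : ∀ δ, MeasurableSet (X ∩ Metric.cthickening δ F) := fun δ =>
    hX.measurableSet.inter Metric.isClosed_cthickening.measurableSet
  rw [hμ.invariant (X ∩ Metric.cthickening (c * δ) F) inter_subset_left (hmeas _)]
  calc μ (X ∩ Metric.cthickening δ F)
      = ∫⁻ x in X ∩ Metric.cthickening δ F, ∑ i, ENNReal.ofReal (p i x) ∂μ := by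
        rw [← setLIntegral_one]
        refine setLIntegral_congr_fun (hmeas δ) fun x hx => ?_
        rw [← ENNReal.ofReal_sum_of_nonneg fun i _ => (hp.mem_Ioo i x hx.1).1.le,
          hp.sum_eq_one x hx.1, ENNReal.ofReal_one]
    _ = ∑ i, ∫⁻ x in X ∩ Metric.cthickening δ F, ENNReal.ofReal (p i x) ∂μ :=
        lintegral_finsetSum' _ fun i _ =>
          (((hp.continuousOn i).mono inter_subset_left).aemeasurable (hmeas δ)).ennreal_ofReal
    _ ≤ _ := by
        refine Finset.sum_le_sum fun i _ => lintegral_mono_set ?_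
        rintro x ⟨hxX, hx⟩
        refine ⟨hxX, hmaps i hxX, ?_⟩
        rw [hF.isCompact.cthickening_eq_biUnion_closedBall hδ] at hx
        obtain ⟨y, hy, hxy⟩ := mem_iUnion₂.1 hx
        refine Metric.mem_cthickening_of_dist_le _ (φ i y) _ _ (hF.mapsTo i hy) ?_
        exact ((hlip i).dist_le_mul x hxX y (hF.subset hy)).trans
          (mul_le_mul_of_nonneg_left hxy c.coe_nonneg)

/-- The invariant measure does not charge the complement of the limit set. -/
theorem IsInvariantMeasure.measure_compl_limitSet (hX : IsCompact X) (hF : IsLimitSet φ X F)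
    (hmaps : ∀ i, MapsTo (φ i) X X) {c : ℝ≥0} (hc : c < 1) (hlip : ∀ i, LipschitzOnWith c (φ i) X)
    (hp : IsPlaceDependentProb p X) (hμ : IsInvariantMeasure φ p X μ) : μ Fᶜ = 0 := by
  have := hμ.isProbabilityMeasure
  set D := Metric.diam X
  have hD : 0 ≤ D := Metric.diam_nonneg
  have hbound : ∀ n : ℕ, 1 ≤ μ (X ∩ Metric.cthickening ((c : ℝ) ^ n * D) F) := by
    intro n
    induction n with
    | zero =>
      have hXF : X ∩ Metric.cthickening ((c : ℝ) ^ 0 * D) F = X := by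
        refine inter_eq_left.2 fun x hx => ?_
        obtain ⟨y, hy⟩ := hF.nonempty
        refine Metric.mem_cthickening_of_dist_le _ y _ _ hy ?_
        simpa using Metric.dist_le_diam_of_mem hX.isBounded hx (hF.subset hy)
      rw [hXF]
      exact ((prob_compl_eq_zero_iff hX.measurableSet).1 hμ.compl_eq_zero).ge
    | succ n ih =>
      rw [pow_succ', mul_assoc]
      exact ih.trans (hμ.measure_cthickening_le hX hF hmaps hlip hp (by positivity))
  have hlim : Filter.Tendsto (fun n : ℕ => (c : ℝ) ^ n * D) Filter.atTop (nhds 0) := by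
    simpa using (tendsto_pow_atTop_nhds_zero_of_lt_one c.coe_nonneg
      (by exact_mod_cast hc)).mul_const D
  have htend := (tendsto_measure_cthickening_of_isClosed (μ := μ)
    ⟨1, one_pos, measure_ne_top _ _⟩ hF.isCompact.isClosed).comp hlim
  have hone : 1 ≤ μ F :=
    ge_of_tendsto' htend fun n => (hbound n).trans (measure_mono inter_subset_right)
  exact (prob_compl_eq_zero_iff hF.isCompact.measurableSet).2 (le_antisymm prob_le_one hone)

/-- Separation kills every term of the invariance formula except the `i`-th, and injectivity
identifies the remaining preimage with `B`. -/
theorem IsInvariantMeasure.measure_image_eq (hF : IsLimitSet φ X F)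
    (hsep : StrongSeparation φ F) (hinj : ∀ i, InjOn (φ i) F) (hcont : ∀ i, ContinuousOn (φ i) F)
    (hμ : IsInvariantMeasure φ p X μ) (hμF : μ Fᶜ = 0) (i : Λ) {B : Set E} (hB : IsCompact B)
    (hBF : B ⊆ F) : μ (φ i '' B) = ∫⁻ x in B, ENNReal.ofReal (p i x) ∂μ := by
  have hsub : φ i '' B ⊆ F := (hF.mapsTo i).image_subset.trans' (image_mono hBF)
  rw [hμ.invariant _ (hsub.trans hF.subset)
    (hB.image_of_continuousOn ((hcont i).mono hBF)).measurableSet]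
  -- Separation is known only on `F`: points of `X` outside `F` might enter `φ i '' B` under another
  -- map, but they form a null set.
  have hres : ∀ j, (X ∩ φ j ⁻¹' (φ i '' B) : Set E) =ᵐ[μ] (F ∩ φ j ⁻¹' (φ i '' B) : Set E) := by
    intro j
    have hFae : ∀ᵐ x ∂μ, x ∈ F := hμF
    filter_upwards [hFae] with x hx
    exact propext ⟨fun h => ⟨hx, h.2⟩, fun h => ⟨hF.subset hx, h.2⟩⟩
  rw [Finset.sum_eq_single i]
  · rw [setLIntegral_congr (hres i)]
    congr 2
    ext x
    constructor
    · rintro ⟨hx, y, hy, hyx⟩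
      rwa [← hinj i (hBF hy) hx hyx]
    · exact fun hx => ⟨hBF hx, x, hx, rfl⟩
  · intro j _ hji
    rw [setLIntegral_congr (hres j)]
    have : F ∩ φ j ⁻¹' (φ i '' B) = ∅ := by
      refine eq_empty_of_forall_notMem ?_
      rintro x ⟨hx, y, hy, hyx⟩
      exact disjoint_left.1 (hsep j i hji) (mem_image_of_mem _ hx) ⟨y, hBF hy, hyx⟩
    simp [this]
  · simp

variable [Nonempty E]

/-- The measure of a cylinder is comparable to the product of the place dependent probabilities. -/
theorem IsInvariantMeasure.measure_cylinder_bounds (hF : IsLimitSet φ X F)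
    (hcode : ∀ w, ⋂ n : ℕ, wordMap φ w (n + 1) '' F = {codingMap φ F w})
    (hsep : StrongSeparation φ F) (hinj : ∀ i, InjOn (φ i) F) (hcont : ∀ i, ContinuousOn (φ i) F)
    (hp : IsPlaceDependentProb p X) (hμ : IsInvariantMeasure φ p X μ) (hμF : μ Fᶜ = 0)
    {ω : ℕ → ℝ} {b : (ℕ → Λ) → ℝ}
    (hb : ∀ w, b w = Real.log (p (w 0) (codingMap φ F (wordShift w))))
    (hu : ∀ n w, ∀ v ∈ PiNat.cylinder w (n + 1), |b w - b v| ≤ ω n) (n : ℕ) :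
    ∀ w, ENNReal.ofReal (Real.exp (-∑ k ∈ Finset.range n, ω k + birkhoffSum wordShift b n w)) ≤
        μ (codingMap φ F '' PiNat.cylinder w n) ∧
      μ (codingMap φ F '' PiNat.cylinder w n) ≤
        ENNReal.ofReal (Real.exp (∑ k ∈ Finset.range n, ω k + birkhoffSum wordShift b n w)) := by
  induction n with
  | zero =>
    intro w
    have := hμ.isProbabilityMeasure
    rw [PiNat.cylinder_zero, image_univ, range_codingMap hF hcode,
      (prob_compl_eq_zero_iff hF.isCompact.measurableSet).1 hμF]
    simp
  | succ n ih =>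
    intro w
    obtain ⟨ih1, ih2⟩ := ih (wordShift w)
    set B := codingMap φ F '' PiNat.cylinder (wordShift w) n with hBdef
    have hB : IsCompact B := isCompact_codingMap_image_cylinder hF hcode hcont n _
    have hBF : B ⊆ F := by
      rintro _ ⟨v, -, rfl⟩
      exact codingMap_mem hF hcode v
    have hpB : ∀ x ∈ B, Real.exp (-ω n + b w) ≤ p (w 0) x ∧ p (w 0) x ≤ Real.exp (ω n + b w) := by
      rintro _ ⟨v, hv, rfl⟩
      -- Prepending `w 0` to `v` expresses the probability at `π v` through `b`, whose variation is
      -- controlled.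
      let u : ℕ → Λ := fun k => Nat.casesOn k (w 0) v
      have hbu : b u = Real.log (p (w 0) (codingMap φ F v)) := hb u
      have hpos := (hp.mem_Ioo (w 0) _ (hF.subset (codingMap_mem hF hcode v))).1
      have h1 := abs_le.1 (hu n w u (mem_cylinder_succ_iff.2 ⟨rfl, hv⟩))
      rw [hbu] at h1
      rw [← Real.le_log_iff_exp_le hpos, ← Real.log_le_iff_le_exp hpos]
      exact ⟨by linarith, by linarith⟩
    rw [codingMap_image_cylinder_succ hF hcode,
      hμ.measure_image_eq hF hsep hinj hcont hμF (w 0) hB hBF, birkhoffSum_succ',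
      Finset.sum_range_succ]
    constructor
    · calc _ = ENNReal.ofReal (Real.exp (-ω n + b w)) * ENNReal.ofReal (Real.exp
            (-∑ k ∈ Finset.range n, ω k + birkhoffSum wordShift b n (wordShift w))) := by
            rw [← ENNReal.ofReal_mul (Real.exp_pos _).le, ← Real.exp_add]
            congr 2
            ring
        _ ≤ ENNReal.ofReal (Real.exp (-ω n + b w)) * μ B := mul_le_mul_right ih1 _
        _ = ∫⁻ _ in B, ENNReal.ofReal (Real.exp (-ω n + b w)) ∂μ := (setLIntegral_const _ _).symm
        _ ≤ _ := setLIntegral_mono' hB.measurableSet fun x hx =>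
            ENNReal.ofReal_le_ofReal (hpB x hx).1
    · calc _ ≤ ∫⁻ _ in B, ENNReal.ofReal (Real.exp (ω n + b w)) ∂μ :=
            setLIntegral_mono' hB.measurableSet fun x hx => ENNReal.ofReal_le_ofReal (hpB x hx).2
        _ = ENNReal.ofReal (Real.exp (ω n + b w)) * μ B := setLIntegral_const _ _
        _ ≤ ENNReal.ofReal (Real.exp (ω n + b w)) * ENNReal.ofReal (Real.exp
            (∑ k ∈ Finset.range n, ω k + birkhoffSum wordShift b n (wordShift w))) :=
            mul_le_mul_right ih2 _
        _ = _ := by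
            rw [← ENNReal.ofReal_mul (Real.exp_pos _).le, ← Real.exp_add]
            congr 2
            ring

end InvariantMeasure

/-! ### Periodic products as Birkhoff sums. -/

/-- The logarithm of the place dependent probability of the first letter of a word. -/
noncomputable def logProb {Λ E : Type*} [Nonempty E] (φ : Λ → E → E) (F : Set E) (p : Λ → E → ℝ) (w : ℕ → Λ) : ℝ :=
  Real.log (p (w 0) (codingMap φ F (wordShift w)))

theorem log_periodProb {Λ E : Type*} [Nonempty E] {φ : Λ → E → E} {F : Set E} {p : Λ → E → ℝ}
    (hpos : ∀ i w, 0 < p i (codingMap φ F w)) (w : ℕ → Λ) :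
    Real.log (periodProb φ F p w) =
      birkhoffSum wordShift (logProb φ F p) (Function.minimalPeriod wordShift w) w := by
  rw [periodProb, wordProb, Real.log_prod fun k _ => (hpos _ _).ne']
  refine Finset.sum_congr rfl fun k _ => ?_
  rw [logProb, ← Function.iterate_succ_apply' wordShift, wordShift_iterate_apply, zero_add]

section Derivative

variable {Λ E : Type*} [NormedAddCommGroup E] [NormedSpace ℝ E] {φ : Λ → E → E} {X F : Set E}

/-- The logarithm of the contraction rate of the first letter of a word. -/
noncomputable def logRate (φ : Λ → E → E) (F : Set E) (w : ℕ → Λ) : ℝ :=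
  Real.log ‖fderiv ℝ (φ (w 0)) (codingMap φ F (wordShift w))‖

/-- By conformality each derivative scales all vectors equally, so the chain rule gives an exact
product. For a periodic word the base point `π (σ^n w)` is `π w` itself. -/
theorem exists_hasFDerivAt_wordMap (hF : IsLimitSet φ X F)
    (hcode : ∀ w, ⋂ n : ℕ, wordMap φ w (n + 1) '' F = {codingMap φ F w})
    (hdiff : ∀ i, ∀ x ∈ F, DifferentiableAt ℝ (φ i) x) (hconf : ∀ i, ∀ x ∈ F, ConformalAt (φ i) x)
    (hpos : ∀ i, ∀ x ∈ F, 0 < ‖fderiv ℝ (φ i) x‖) (n : ℕ) :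
    ∀ w, wordMap φ w n (codingMap φ F (wordShift^[n] w)) = codingMap φ F w ∧
      ∃ L : E →L[ℝ] E, HasFDerivAt (wordMap φ w n) L (codingMap φ F (wordShift^[n] w)) ∧
        ∀ v, ‖L v‖ = Real.exp (birkhoffSum wordShift (logRate φ F) n w) * ‖v‖ := by
  induction n with
  | zero => exact fun w => ⟨rfl, ContinuousLinearMap.id ℝ E, hasFDerivAt_id _, by simp⟩
  | succ n ih =>
    intro w
    obtain ⟨hπ, L, hL, hnorm⟩ := ih (wordShift w)
    have hmem := codingMap_mem hF hcode (wordShift w)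
    have hd := (hdiff (w 0) _ hmem).hasFDerivAt
    rw [wordMap_succ', Function.iterate_succ_apply]
    refine ⟨by rw [Function.comp_apply, hπ, ← codingMap_eq_apply hF hcode], _,
      HasFDerivAt.comp _ (by rw [hπ]; exact hd) hL, fun v => ?_⟩
    rw [ContinuousLinearMap.comp_apply, (hconf (w 0) _ hmem).norm_fderiv_apply, hnorm,
      birkhoffSum_succ', Real.exp_add, logRate, Real.exp_log (hpos _ _ hmem), mul_assoc]

theorem log_periodDeriv [Nontrivial E] (hF : IsLimitSet φ X F)
    (hcode : ∀ w, ⋂ n : ℕ, wordMap φ w (n + 1) '' F = {codingMap φ F w})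
    (hdiff : ∀ i, ∀ x ∈ F, DifferentiableAt ℝ (φ i) x) (hconf : ∀ i, ∀ x ∈ F, ConformalAt (φ i) x)
    (hpos : ∀ i, ∀ x ∈ F, 0 < ‖fderiv ℝ (φ i) x‖) (w : ℕ → Λ) :
    Real.log (periodDeriv φ F w) =
      birkhoffSum wordShift (logRate φ F) (Function.minimalPeriod wordShift w) w := by
  obtain ⟨-, L, hL, hnorm⟩ := exists_hasFDerivAt_wordMap hF hcode hdiff hconf hpos
    (Function.minimalPeriod wordShift w) w
  rw [Function.iterate_minimalPeriod] at hL
  rw [periodDeriv, hL.fderiv, ContinuousLinearMap.homothety_norm _ hnorm, Real.log_exp]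

end Derivative

/-! ### Verification of the Gibbs property and conclusion. -/

/-- A potential that is asymptotic to the logarithms of the contraction rates of a coding is bounded
away from zero. -/
theorem le_log_of_abs_log_dist_le {Λ E : Type*} [Nontrivial Λ] [MetricSpace E]
    {π : (ℕ → Λ) → E} (hinj : Function.Injective π) {ω : ℕ → ℝ} (hω : Summable ω)
    {a : (ℕ → Λ) → ℝ}
    (hu : ∀ n w, ∀ v ∈ PiNat.cylinder w (n + 1), v ≠ w →
      |Real.log (dist (π v) (π w)) - Real.log (dist (π (wordShift v)) (π (wordShift w))) - a w| ≤
        ω n) {c : ℝ} (hc : 0 < c)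
    (hlip : ∀ w v, v 0 = w 0 → dist (π v) (π w) ≤ c * dist (π (wordShift v)) (π (wordShift w)))
    (w : ℕ → Λ) : a w ≤ Real.log c := by
  have hbound : ∀ n, a w ≤ Real.log c + ω n := by
    intro n
    -- Changing a single late letter gives a nearby coded point, whose distance contracts by at most
    -- `c`; the error `ω n` tends to zero. Only Lipschitz bounds on coded points enter, so these
    -- need no neighbourhood inside `X`.
    obtain ⟨i, hi⟩ := exists_ne (w (n + 1))
    classical
    set v := Function.update w (n + 1) i
    have hv : v ∈ PiNat.cylinder w (n + 1) := fun k hk => Function.update_of_ne hk.ne _ _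
    have hne : v ≠ w := fun h => hi (by simpa [v] using congrFun h (n + 1))
    have hne' : wordShift v ≠ wordShift w := fun h =>
      hi (by simpa [v, wordShift] using congrFun h n)
    have h1 := abs_le.1 (hu n w v hv hne)
    have hpos' : 0 < dist (π (wordShift v)) (π (wordShift w)) := dist_pos.2 (hinj.ne hne')
    have h2 := Real.log_le_log (dist_pos.2 (hinj.ne hne)) (hlip w v (hv 0 (by omega)))
    rw [Real.log_mul hc.ne' hpos'.ne'] at h2
    linarith
  have := hω.tendsto_atTop_zero.const_add (Real.log c)
  rw [add_zero] at this
  exact ge_of_tendsto' this hbound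

theorem mainTheorem2 {Λ : Type*} [Fintype Λ] {d : ℕ}
    (φ : Λ → EuclideanSpace ℝ (Fin d) → EuclideanSpace ℝ (Fin d))
    (Ω X F : Set (EuclideanSpace ℝ (Fin d)))
    (p : Λ → EuclideanSpace ℝ (Fin d) → ℝ)
    (μ : Measure (EuclideanSpace ℝ (Fin d)))
    (hφ : IsSelfConformalIFS φ Ω X)
    (hF : IsLimitSet φ X F)
    (hsep : StrongSeparation φ F)
    (hp : IsPlaceDependentProb p X)
    (hμ : IsInvariantMeasure φ p X μ) :
    assouadDim μ =
      ⨆ w ∈ Function.periodicPts (wordShift (Λ := Λ)),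
        ((Real.log (periodProb φ F p w) / Real.log (periodDeriv φ F w) : ℝ) : EReal) := by
  have hcode := iInter_wordMap_image_eq hφ hF
  obtain ⟨x₀, hx₀⟩ := hF.nonempty
  have hΛne : Nonempty Λ := by
    rw [hF.eq_iUnion] at hx₀
    exact ⟨(mem_iUnion.1 hx₀).choose⟩
  -- A single letter would have probability `1`, outside the open interval.
  have hΛ : Nontrivial Λ := by
    by_contra h
    rw [not_nontrivial_iff_subsingleton] at h
    obtain ⟨i⟩ := hΛne
    have h1 := hp.sum_eq_one x₀ (hF.subset hx₀)
    rw [Fintype.sum_subsingleton _ i] at h1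
    exact absurd h1 (hp.mem_Ioo i x₀ (hF.subset hx₀)).2.ne
  have hFΩ : F ⊆ Ω := hF.subset.trans hφ.subset
  have hinj : ∀ i, InjOn (φ i) F := fun i => (hφ.injOn i).mono hFΩ
  -- Two separated images exclude `d = 0`, where derivative norms vanish.
  have hE : Nontrivial (EuclideanSpace ℝ (Fin d)) := by
    obtain ⟨i, j, hij⟩ := exists_pair_ne Λ
    exact ⟨φ i x₀, φ j x₀, fun h => disjoint_left.1 (hsep i j hij) (mem_image_of_mem _ hx₀)
      (h ▸ mem_image_of_mem _ hx₀)⟩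
  obtain ⟨c, hc0, hc1, hlip⟩ : ∃ c : ℝ≥0, 0 < c ∧ c < 1 ∧ ∀ i, LipschitzOnWith c (φ i) X := by
    choose c hc hL using hφ.contraction
    obtain ⟨i, hi⟩ := Finite.exists_max c
    -- The value `2⁻¹` keeps `c` positive, so that `log c < 0`.
    exact ⟨max (c i) 2⁻¹, lt_max_of_lt_right (by norm_num), max_lt (hc i) (by norm_num),
      fun j => (hL j).weaken ((hi j).trans (le_max_left _ _))⟩
  have hlipF : ∀ i, LipschitzOnWith c (φ i) F := fun i => (hlip i).mono hF.subset
  have hcont : ∀ i, ContinuousOn (φ i) F := fun i => (hlipF i).continuousOn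
  have hmem := codingMap_mem hF hcode
  have hrange := range_codingMap hF hcode
  have hπ := codingMap_injective hF hcode hsep hinj
  have hdist := dist_codingMap_le hF hcode hlipF
  have hμF := hμ.measure_compl_limitSet hφ.isCompact hF hφ.mapsTo_compact hc1 hlip hp
  obtain ⟨ω, hω0, hω, hωa⟩ := exists_summable_bound
    (fun i => exists_abs_log_dist_sub_log_norm_fderiv_le hφ.isOpen hF.isCompact hFΩ
      (hφ.contDiffOn i) (hφ.holder_fderiv i) (hφ.conformal i) (hlipF i) (hinj i))
    c.coe_nonneg (by exact_mod_cast hc1) (Metric.diam_nonneg (s := F))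
  obtain ⟨η, hη0, hη, hηb⟩ := exists_summable_bound (F := F)
    (fun i => exists_abs_log_sub_log_le_of_holder hF.isCompact
      (by
        obtain ⟨α, C, hα, hC⟩ := hp.holder i
        exact ⟨α, C, hα, hC.mono hF.subset⟩)
      fun x hx => (hp.mem_Ioo i x (hF.subset hx)).1)
    c.coe_nonneg (by exact_mod_cast hc1) (Metric.diam_nonneg (s := F))
  have hshift : ∀ {n : ℕ} {w v : ℕ → Λ}, v ∈ PiNat.cylinder w (n + 1) → v ≠ w →
      codingMap φ F (wordShift v) ≠ codingMap φ F (wordShift w) := by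
    intro n w v hv hne h
    refine hne (funext fun k => ?_)
    cases k with
    | zero => exact hv 0 (by omega)
    | succ k => exact congrFun (hπ h) k
  have ha : ∀ n w, ∀ v ∈ PiNat.cylinder w (n + 1), v ≠ w →
      |Real.log (dist (codingMap φ F v) (codingMap φ F w)) -
        Real.log (dist (codingMap φ F (wordShift v)) (codingMap φ F (wordShift w))) -
        logRate φ F w| ≤ ω n := by
    intro n w v hv hne
    have h := hωa n (w 0) _ (hmem (wordShift w)) _ (hmem (wordShift v)) (hshift hv hne)
      (hdist n _ _ (wordShift_mem_cylinder hv))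
    rwa [← codingMap_eq_apply hF hcode w, ← hv 0 (by omega), ← codingMap_eq_apply hF hcode v,
      hv 0 (by omega)] at h
  -- Exchanging `v` and `w` in `ha` leaves the distances unchanged, so both rates approximate the
  -- same number to within `ω n`.
  have ha' : ∀ n w, ∀ v ∈ PiNat.cylinder w (n + 1), |logRate φ F w - logRate φ F v| ≤ 2 * ω n := by
    intro n w v hv
    rcases eq_or_ne v w with rfl | hne
    · simpa using hω0 n
    have h1 := abs_le.1 (ha n w v hv hne)
    have h2 := ha n v w ((PiNat.mem_cylinder_comm _ _ _).1 hv) hne.symm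
    rw [dist_comm, dist_comm (codingMap φ F (wordShift w))] at h2
    have h2 := abs_le.1 h2
    exact abs_le.2 ⟨by linarith, by linarith⟩
  have hb : ∀ n w, ∀ v ∈ PiNat.cylinder w (n + 1), |logProb φ F p w - logProb φ F p v| ≤ η n := by
    intro n w v hv
    rcases eq_or_ne v w with rfl | hne
    · simpa using hη0 n
    rw [abs_sub_comm, logProb, logProb, hv 0 (by omega)]
    exact hηb n (w 0) _ (hmem (wordShift w)) _ (hmem (wordShift v)) (hshift hv hne)
      (hdist n _ _ (wordShift_mem_cylinder hv))
  have haθ : ∀ w, logRate φ F w ≤ Real.log c := by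
    refine le_log_of_abs_log_dist_le hπ hω ha hc0 fun w v h0 => ?_
    rw [codingMap_eq_apply hF hcode w, codingMap_eq_apply hF hcode v, h0]
    exact (hlipF _).dist_le_mul _ (hmem _) _ (hmem _)
  have hlogc : Real.log c < 0 := Real.log_neg hc0 (by exact_mod_cast hc1)
  have hpos : ∀ i, ∀ x ∈ F, 0 < ‖fderiv ℝ (φ i) x‖ := fun i x hx =>
    (hφ.conformal i x (hFΩ hx)).norm_fderiv_pos
  have haM : ∃ M, ∀ w, -M ≤ logRate φ F w := by
    choose m hm0 hm using fun i => exists_le_norm_fderiv hφ.isOpen hF.isCompact hFΩ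
      (hφ.contDiffOn i) (hφ.conformal i)
    obtain ⟨i, hi⟩ := Finite.exists_min m
    refine ⟨-Real.log (m i), fun w => ?_⟩
    rw [neg_neg]
    exact Real.log_le_log (hm0 i) ((hi _).trans (hm _ _ (hmem _)))
  obtain ⟨M, hM⟩ := haM
  obtain ⟨δ, hδ, hδsep⟩ := exists_separation hF hcode hsep hcont
  obtain ⟨C, hC1, hC2⟩ := exists_const_dist_codingMap hπ hω0 hω (fun w => (haθ w).trans hlogc.le)
    ha (fun w v => Metric.dist_le_diam_of_mem hF.isCompact.isBounded (hmem v) (hmem w)) hδ hδsep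
  have hcyl := hμ.measure_cylinder_bounds hF hcode hsep hinj hcont hp hμF
    (b := logProb φ F p) (fun _ => rfl) hb
  have hSω : ∀ n, ∑ k ∈ Finset.range n, 2 * ω k ≤ ∑' k, 2 * ω k := fun n =>
    (hω.mul_left 2).sum_le_tsum _ fun k _ => mul_nonneg zero_le_two (hω0 k)
  have hSη : ∀ n, ∑ k ∈ Finset.range n, η k ≤ ∑' k, η k := fun n =>
    hη.sum_le_tsum _ fun k _ => hη0 k
  set C' := max C (max (∑' k, 2 * ω k) (∑' k, η k))
  have hCC' : C ≤ C' := le_max_left _ _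
  have hωC' : ∀ n, ∑ k ∈ Finset.range n, 2 * ω k ≤ C' := fun n =>
    (hSω n).trans ((le_max_left _ _).trans (le_max_right _ _))
  have hηC' : ∀ n, ∑ k ∈ Finset.range n, η k ≤ C' := fun n =>
    (hSη n).trans ((le_max_right _ _).trans (le_max_right _ _))
  have hgibbs : IsGibbsCoding (codingMap φ F) μ (logRate φ F) (logProb φ F p) C' :=
    { distortion_fst := fun n w v hv => (abs_birkhoffSum_sub_le ha' n w v hv).trans (hωC' n)
      distortion_snd := fun n w v hv => (abs_birkhoffSum_sub_le hb n w v hv).trans (hηC' n)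
      dist_le := fun n w v hv => (hC1 n w v hv).trans (Real.exp_le_exp.2 (by linarith))
      mem_cylinder := fun n w v h =>
        hC2 n w v (h.trans_le (Real.exp_le_exp.2 (by linarith)))
      le_measure := fun n w => (ENNReal.ofReal_le_ofReal
        (Real.exp_le_exp.2 (by linarith [hηC' n]))).trans (hcyl n w).1
      measure_le := fun n w => (hcyl n w).2.trans (ENNReal.ofReal_le_ofReal
        (Real.exp_le_exp.2 (by linarith [hηC' n])))
      compl_range := by rw [hrange, hμF]
      support_subset := by
        rw [hrange]
        exact Measure.support_subset_of_isClosed hF.isCompact.isClosed hμF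
      lt_zero_snd := fun w =>
        have h := hp.mem_Ioo (w 0) _ (hF.subset (hmem (wordShift w)))
        Real.log_neg h.1 h.2
      fst_bound := ⟨-Real.log c, M, by linarith, fun w => ⟨hM w, by simpa using haθ w⟩⟩ }
  rw [hgibbs.assouadDim_eq]
  refine iSup_congr fun w => iSup_congr fun _ => ?_
  rw [log_periodProb fun i v => (hp.mem_Ioo i _ (hF.subset (hmem v))).1,
    log_periodDeriv hF hcode
      (fun i x hx => ((hφ.contDiffOn i).differentiableOn one_ne_zero x (hFΩ hx)).differentiableAt
        (hφ.isOpen.mem_nhds (hFΩ hx)))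
      (fun i x hx => hφ.conformal i x (hFΩ hx)) hpos]
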